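/- Let $\alpha\in(0,1]$ and $1\le s\le k$ be fixed ($s,k$ integers), and consider fractional initial value problems $y^{(\alpha)}(t)=f(y(t))$, $t\in(0,T]$, $y(0)=y_0\in\mathbb R^m$, with the Caputo derivative $y^{(\alpha)}(t)=\frac1{\Gamma(1-\alpha)}\int_0^t(t-x)^{-\alpha}y'(x)\,dx$ (and $y^{(1)}=y'$), where the solution $y$ is absolutely continuous on $[0,T]$. **The method.** Let $P_0,P_1,\dots$ be the shifted Jacobi polynomials ($\deg P_j=j$) with $\alpha\int_0^1(1-c)^{\alpha-1}P_iP_j\,dc=\delta_{ij}$ and positive leading coefficients; $c_1,\dots,c_k$ the zeros of $P_k$ and $b_1,\dots,b_k$ the weights of the interpolatory (Gauss–Jacobi) quadrature at these nodes for the weight function $\alpha(1-c)^{\alpha-1}$; $I^\alpha g(c)=\frac1{\Gamma(\alpha)}\int_0^c(c-\tau)^{\alpha-1}g(\tau)\,d\tau$; and $J_j^\alpha(x)=\int_0^1(x-\tau)^{\alpha-1}P_j(\tau)\,d\tau$. For $r\ge1$, $h_1>0$, $N\ge1$ consider the mesh $t_0=0$, $t_n=t_{n-1}+h_n$, $h_n=r^{n-1}h_1$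 $(1\le n\le N)$ with $t_N=T$; it is called graded if $r>1$, and if $r=1$ the step is constant, $h=h_1=T/N$. A piecewise quasi-polynomial approximation is given by vectors $\gamma_j^n\in\mathbb R^m$ $(1\le n\le N,\ 0\le j<s)$ through $$\sigma_n(ch_n)=y_0+\frac1{\Gamma(\alpha)}\sum_{\nu=1}^{n-1}h_\nu^\alpha\sum_{j<s}J^\alpha_j\Big(\sum_{i=0}^{n-1-\nu}r^i+cr^{\,n-\nu}\Big)\gamma_j^\nu+h_n^\alpha\sum_{j<s}\gamma_j^n\,I^\alpha P_j(c),\qquad c\in[0,1],$$ where the $\gamma_j^n$ solve the discrete problems $\gamma_j^n=\sum_{i=1}^kb_iP_j(c_i)f(\sigma_n(c_ih_n))$. Its error on the $n$-th step is $e_n=\max_{c\in[0,1]}|y(t_{n-1}+ch_n)-\sigma_n(ch_n)|$ (Euclidean norm). Put $\gamma_j(\sigma_n)=\alpha\int_0^1(1-c)^{\alpha-1}P_j(c)f(\sigma_n(ch_n))\,dc$, let $\Sigma_j(\sigma_n)=\gamma^n_j-\gamma_j(\sigma_n)$ be the quadrature errors, and let $E_n(\tau)=f(\sigma_n(\tau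 h_n))-\sum_{j<s}P_j(\tau)\gamma_j(\sigma_n)$ be the truncation error, i.e. the tail $\sum_{j\ge s}P_j(\tau)\gamma_j(\sigma_n)$ of the Jacobi expansion of $f(\sigma_n(\tau h_n))$ wherever that expansion converges to it. Call step $\nu$ *regular with constant $C$* if $|\Sigma_j(\sigma_\nu)|\le Ch_\nu^{2k-j}$ for $0\le j<s$ and $|E_\nu(\tau)|\le Ch_\nu^s$ for $\tau\in[0,1]$. **(1) Error bound.** For every $L\ge0$ there is $K_1>0$, for all $T>0$ and $C$ there is $K>0$, and for every $\delta>0$ there is $\bar h>0$ (so $K_1$ depends only on $\alpha,s,k,L$; $K$ only on $\alpha,s,k,L,T,C$; $\bar h$ on these and $\delta$), such that the following holds with $\rho=\exp\big(K_1LT^\alpha/\Gamma(\alpha+1)\big)$ for every dimension $m$, every problem as above with $f$ Lipschitz with constant $L$ on the $\delta$-neighbourhood of $\{y(t):t\in[0,T]\}$, and every graded mesh on $[0,T]$ with $h_N\le\bar h$. If the approximation satisfies $|\Sigma_j(\sigma_1)|\le Ch_1^\alpha$ $(0\le j<s)$ and $|E_1(\tau)|\le Ch_1^\alpha$ $(\tau\in[0,1])$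 on the first step, and the steps $\nu=2,\dots,N$ are regular with constant $C$, then for $0\le n\le N-1$ $$e_{n+1}\le K\rho\Big((n+1)h_1^{2\alpha}+\frac{h_{n+1}^{s+\alpha}}{1-r^{-(s+\alpha)}}\Big)\quad\text{and}\quad e_{n+1}\le K\rho\Big(Nh_1^{2\alpha}+\frac{h_N^{s+\alpha}}{1-r^{-(s+\alpha)}}\Big).$$ **(2) Number of steps.** Every graded mesh on $[0,T]$ has $N=\log_r\big(1+T(r-1)/h_1\big)$. **(3) Optimal balance.** Let $\alpha<s$, $T>0$ and $0<\kappa_1\le\kappa_2$. There are $M>0$ and $N_0$ such that for every $N\ge N_0$: there is a graded mesh on $[0,T]$ with $N$ steps and $h_1^{2\alpha}=h_N^{s+\alpha}$; and for every graded mesh on $[0,T]$ with $N$ steps and $\kappa_1h_N^{s+\alpha}\le h_1^{2\alpha}\le \kappa_2h_N^{s+\alpha}$, the quantity $B=Nh_1^{2\alpha}+h_N^{s+\alpha}/(1-r^{-(s+\alpha)})$ is at most $M\log N$ times its value $B'$ on any other graded mesh on $[0,T]$ with $N$ steps. That is, the bound is optimal, up to a logarithmic factor, when $h_1^{2\alpha}\sim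 h_N^{s+\alpha}$. **(4) Constant step.** For all $L\ge0$, $T>0$ and $C$ there is $K>0$, and for every $\delta>0$ there is $\bar h>0$, such that for every $m$, every problem with $f$ Lipschitz with constant $L$ on the $\delta$-neighbourhood of $\{y(t):t\in[0,T]\}$, and every constant-step mesh $(r=1)$ on $[0,T]$ with $h\le\bar h$ for which all steps $\nu=1,\dots,N$ are regular with constant $C$, one has $e_n\le K\,n\,h^{s+\alpha}$ for $1\le n\le N$. -/

import Mathlib

open scoped NNReal

noncomputable section

namespace FracStep

/-! ### Caputo derivative, Riemann-Liouville integral, the initial value problem -/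

/-- The Riemann-Liouville integral `I^α g (t) = (1/Γ(α)) ∫_0^t (t-x)^(α-1) g(x) dx`. -/
def riemannLiouville (α : ℝ) (g : ℝ → ℝ) (t : ℝ) : ℝ :=
  (1 / Real.Gamma α) * ∫ x in (0 : ℝ)..t, (t - x) ^ (α - 1) * g x

/-- `y : [0,T] → V` has Caputo derivative `v` of order `α ∈ (0,1]` at `t ∈ (0,T]`.  For `α < 1` this
means that the integral in `(1/Γ(1-α)) ∫_0^t (t-x)^(-α) y'(x) dx` converges and that the whole
expression equals `v`; for `α = 1` the Caputo derivative is the ordinary derivative. -/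
def HasCaputoDeriv {V : Type*} [NormedAddCommGroup V] [NormedSpace ℝ V]
    (α T : ℝ) (y : ℝ → V) (t : ℝ) (v : V) : Prop :=
  (α < 1 →
    IntervalIntegrable (fun x => (t - x) ^ (-α) • deriv y x) MeasureTheory.volume 0 t ∧
    (1 / Real.Gamma (1 - α)) • (∫ x in (0 : ℝ)..t, (t - x) ^ (-α) • deriv y x) = v) ∧
  (α = 1 → HasDerivWithinAt y v (Set.Icc 0 T) t)

/-- `y` solves `y^(α)(t) = f(y(t))` on `(0,T]`, `y(0) = y₀`. -/
structure IsFracSolution {V : Type*} [NormedAddCommGroup V] [NormedSpace ℝ V]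
    (α T : ℝ) (f : V → V) (y₀ : V) (y : ℝ → V) : Prop where
  absCont : AbsolutelyContinuousOnInterval y 0 T
  init : y 0 = y₀
  eqn : ∀ t ∈ Set.Ioc 0 T, HasCaputoDeriv α T y t (f (y t))

/-! ### Orthonormal Jacobi polynomials and the Gauss-Jacobi formula -/

/-- The classical Jacobi polynomial of degree `n` with parameters `(a, b)`,
`∑_m (1/n!) (n choose m) (a+b+n+1)_m (a+m+1)_{n-m} ((x-1)/2)^m`, where `(z)_m` is the rising
factorial. -/
def jacobi (a b : ℝ) (n : ℕ) : Polynomial ℝ :=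
  ∑ m ∈ Finset.range (n + 1),
    Polynomial.C (((n.choose m : ℝ) / (n.factorial : ℝ)) *
      (ascPochhammer ℝ m).eval (a + b + n + 1) * (ascPochhammer ℝ (n - m)).eval (a + m + 1)) *
      (Polynomial.C (1 / 2) * (Polynomial.X - 1)) ^ m

/-- The shifted and scaled Jacobi polynomial `P_i`, orthonormal on `[0,1]` for the weight
`α (1-c)^(α-1)`. -/
def P (α : ℝ) (i : ℕ) : Polynomial ℝ :=
  Polynomial.C (Real.sqrt (2 * i + α) / Real.sqrt α) *
    (jacobi (α - 1) 0 i).comp (2 * Polynomial.X - 1)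

/-- The abscissae of the Gauss-Jacobi formula of order `2k`: the zeros of `P_k`. -/
def nodes (α : ℝ) (k : ℕ) : Finset ℝ := (P α k).roots.toFinset

/-- The weight of the Gauss-Jacobi formula at the abscissa `x`. -/
def weight (α : ℝ) (k : ℕ) (x : ℝ) : ℝ :=
  α * ∫ c in (0 : ℝ)..1, (1 - c) ^ (α - 1) * (Lagrange.basis (nodes α k) id x).eval c

/-- `I^α P_j (c)`. -/
def IP (α : ℝ) (j : ℕ) (c : ℝ) : ℝ := riemannLiouville α (fun x => (P α j).eval x) c

/-- `J_j^α(x) = ∫_0^1 (x-τ)^(α-1) P_j(τ) dτ`. -/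
def J (α : ℝ) (j : ℕ) (x : ℝ) : ℝ := ∫ τ in (0 : ℝ)..1, (x - τ) ^ (α - 1) * (P α j).eval τ

/-! ### Meshes -/

/-- The time steps `h_n = r^(n-1) h₁`, `n ≥ 1`. -/
def step (r h₁ : ℝ) (n : ℕ) : ℝ := r ^ (n - 1) * h₁

/-- The mesh points `t_n = h_1 + ... + h_n`. -/
def meshPoint (r h₁ : ℝ) (n : ℕ) : ℝ := ∑ ν ∈ Finset.Icc 1 n, step r h₁ ν

/-- The mesh with `N` steps `h_n = r^(n-1) h₁` covers exactly `[0,T]`. -/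
structure IsMesh (T r h₁ : ℝ) (N : ℕ) : Prop where
  one_le : 1 ≤ N
  pos : 0 < h₁
  total : meshPoint r h₁ N = T

section Method

variable {V : Type*} [NormedAddCommGroup V] [NormedSpace ℝ V]

/-- The discrete history term `φ_n(c)`.  The sum `∑_{i < n-ν+1} r^i` is `(r^(n-ν+1)-1)/(r-1)` for
`r ≠ 1`, and its limit `n-ν+1` for `r = 1`.  Here `γ ν j` is the `j`-th discrete Fourier coefficient
of step `ν ≥ 1`. -/
def history (α : ℝ) (s : ℕ) (r h₁ : ℝ) (y₀ : V) (γ : ℕ → ℕ → V) (n : ℕ) (c : ℝ) : V :=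
  y₀ + (1 / Real.Gamma α) • ∑ ν ∈ Finset.Icc 1 n, (step r h₁ ν ^ α) •
    ∑ j ∈ Finset.range s,
      J α j ((∑ i ∈ Finset.range (n - ν + 1), r ^ i) + c * r ^ (n - ν + 1)) • γ ν j

/-- The quasi-polynomial `c ↦ σ_n(c h_n)`, `c ∈ [0,1]`, of step `n ≥ 1`. -/
def quasiPoly (α : ℝ) (s : ℕ) (r h₁ : ℝ) (y₀ : V) (γ : ℕ → ℕ → V) (n : ℕ) (c : ℝ) : V :=
  history α s r h₁ y₀ γ (n - 1) c +
    (step r h₁ n ^ α) • ∑ j ∈ Finset.range s, IP α j c • γ n j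

/-- The Fourier coefficient `α ∫_0^1 (1-c)^(α-1) P_j(c) f(u(c)) dc`. -/
def fourierCoeff (α : ℝ) (f : V → V) (u : ℝ → V) (j : ℕ) : V :=
  α • ∫ c in (0 : ℝ)..1, ((1 - c) ^ (α - 1) * (P α j).eval c) • f (u c)

/-- The Gauss-Jacobi approximation (order `2k`) of the `j`-th Fourier coefficient. -/
def quadCoeff (α : ℝ) (k : ℕ) (f : V → V) (u : ℝ → V) (j : ℕ) : V :=
  ∑ x ∈ nodes α k, (weight α k x * (P α j).eval x) • f (u x)

/-- The vectors `γ ν j`, `1 ≤ ν ≤ N`, `j < s`, solve the discrete problems of all `N` steps: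
`γ ν j` is the quadrature approximation of the `j`-th Fourier coefficient of `f(σ_ν)`, where `σ_ν`
is built from the `γ`'s of the steps `1, ..., ν`. -/
def IsDiscreteSolution (α : ℝ) (k s : ℕ) (r h₁ : ℝ) (N : ℕ) (f : V → V) (y₀ : V)
    (γ : ℕ → ℕ → V) : Prop :=
  ∀ ν ∈ Finset.Icc 1 N, ∀ j < s, γ ν j = quadCoeff α k f (quasiPoly α s r h₁ y₀ γ ν) j

/-- The quadrature error `Σ_j`. -/
def quadError (α : ℝ) (k : ℕ) (f : V → V) (u : ℝ → V) (j : ℕ) : V :=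
  quadCoeff α k f u j - fourierCoeff α f u j

/-- The truncation error `E(τ)`: the remainder after `s` terms of the Jacobi expansion of `f(u)`. -/
def truncError (α : ℝ) (s : ℕ) (f : V → V) (u : ℝ → V) (τ : ℝ) : V :=
  f (u τ) - ∑ j ∈ Finset.range s, (P α j).eval τ • fourierCoeff α f u j

/-- Wherever the Jacobi expansion of `f(u)` converges to `f(u)`, the truncation error is the tail
`∑_{j ≥ s}` of the expansion. -/
theorem tendsto_truncError (α : ℝ) (s : ℕ) (f : V → V) (u : ℝ → V) (τ : ℝ)
    (h : Filter.Tendsto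
      (fun M => ∑ j ∈ Finset.range M, (P α j).eval τ • fourierCoeff α f u j)
      Filter.atTop (nhds (f (u τ)))) :
    Filter.Tendsto
      (fun M => ∑ j ∈ Finset.Ico s M, (P α j).eval τ • fourierCoeff α f u j)
      Filter.atTop (nhds (truncError α s f u τ)) := by
  refine (h.sub_const _).congr' ?_
  filter_upwards [Filter.eventually_ge_atTop s] with M hM
  rw [Finset.sum_Ico_eq_sub _ hM]

/-- The set of the errors `|y(t_{n-1} + c h_n) - σ_n(c h_n)|`, `c ∈ [0,1]`. -/
def errorSet (α : ℝ) (s : ℕ) (r h₁ : ℝ) (y₀ : V) (γ : ℕ → ℕ → V) (y : ℝ → V) (n : ℕ) : Set ℝ :=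
  (fun c : ℝ => ‖y (meshPoint r h₁ (n - 1) + c * step r h₁ n) - quasiPoly α s r h₁ y₀ γ n c‖) ''
    Set.Icc 0 1

/-- The error `e_n` of step `n`, as a supremum. -/
def stepError (α : ℝ) (s : ℕ) (r h₁ : ℝ) (y₀ : V) (γ : ℕ → ℕ → V) (y : ℝ → V) (n : ℕ) : ℝ :=
  sSup (errorSet α s r h₁ y₀ γ y n)

/-- The bounds, with constant `C`, on quadrature and truncation errors of step `ν` for a vector
field that is regular on that step. -/
def RegularStepBounds (C α : ℝ) (k s : ℕ) (r h₁ : ℝ) (f : V → V) (y₀ : V) (γ : ℕ → ℕ → V)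
    (ν : ℕ) : Prop :=
  (∀ j < s, ‖quadError α k f (quasiPoly α s r h₁ y₀ γ ν) j‖ ≤ C * step r h₁ ν ^ (2 * k - j)) ∧
  (∀ τ ∈ Set.Icc (0 : ℝ) 1,
    ‖truncError α s f (quasiPoly α s r h₁ y₀ γ ν) τ‖ ≤ C * step r h₁ ν ^ s)

/-- The weaker bounds on the first step, where the derivative of the solution may be singular. -/
def SingularFirstStepBounds (C α : ℝ) (k s : ℕ) (r h₁ : ℝ) (f : V → V) (y₀ : V)
    (γ : ℕ → ℕ → V) : Prop :=
  (∀ j < s, ‖quadError α k f (quasiPoly α s r h₁ y₀ γ 1) j‖ ≤ C * h₁ ^ α) ∧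
  (∀ τ ∈ Set.Icc (0 : ℝ) 1, ‖truncError α s f (quasiPoly α s r h₁ y₀ γ 1) τ‖ ≤ C * h₁ ^ α)

end Method

/-- The quantity `N h₁^(2α) + h_N^(s+α) / (1 - r^(-(s+α)))`. -/
def boundTerm (α : ℝ) (s : ℕ) (r h₁ : ℝ) (N : ℕ) : ℝ :=
  N * h₁ ^ (2 * α) + step r h₁ N ^ (s + α) / (1 - r ^ (-(s + α)))

end FracStep

end

/-!
The Caputo problem is equivalent to the Volterra equation
`y(t) = y₀ + (1/Γ(α)) ∫_0^t (t-x)^(α-1) f(y(x)) dx` (Abel inversion, `IsFracSolution.eq_add_integral`;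
for `α = 1` this is the fundamental theorem of calculus). The numerical approximation has the same
form with `f(y)` replaced by the piecewise polynomial `∑_j P_j γ_j^ν` on step `ν`
(`approx_eq_quasiPoly`, `approx_eq_sum_integral`). Subtracting, the error is a Riemann-Liouville
integral of `f(y) - f(σ)` plus the defect `f(σ_ν) - ∑_j P_j γ_j^ν`, and the defect is a combination
of the truncation error and the quadrature errors (`norm_sub_sum_quadCoeff_le`).

If the defect of step `ν` is at most `D_ν`, its contribution to the integral is at most
`D_ν h_ν^α / Γ(α+1)`, since `z ↦ z^α` is subadditive. The sum of these contributions is passed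
through a fractional Gronwall inequality (`le_mul_growth`), proved with an exponential weight. The
Lipschitz condition holds only near the solution, so this is combined with a continuity argument
(`le_mul_growth_of_lt`), for which the sum only has to tend to zero with the largest step; the
result is `norm_sub_quasiPoly_le`. On a graded mesh the first step contributes `h_1^(2α)`, the
others at most the geometric sum `h_n^(s+α) / (1 - r^(-(s+α)))`; with constant step the sum is
`n h^(s+α)`. The Gronwall factor depends on `α, L, T` only and is part of the constant `K`.

For the optimality write `p = s + α` and `q = 2α < p`. On every mesh with `N` steps the bound is at
least a multiple of `(log N / N)^(p-1)` (`exists_le_bound`), and on balanced meshes, which exist by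
the intermediate value theorem, it is at most a multiple of `log N (log N / N)^(p-1)`
(`exists_bound_le`).
-/

noncomputable section

namespace FracStep

open MeasureTheory Set Filter

/-! ### The truncated power kernel -/

/-- The truncated power `z ↦ z₊^β`, set to zero for `z ≤ 0` (also when `β = 0`). With it, the
Riemann-Liouville integral over `[0,t]` is an integral over any larger interval. -/
def kern (β z : ℝ) : ℝ := (Ioi (0 : ℝ)).indicator (fun z => z ^ β) z

theorem kern_of_pos (β : ℝ) {z : ℝ} (hz : 0 < z) : kern β z = z ^ β :=
  indicator_of_mem (mem_Ioi.2 hz) _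

theorem kern_of_nonpos (β : ℝ) {z : ℝ} (hz : z ≤ 0) : kern β z = 0 :=
  indicator_of_notMem (by simpa using hz) _

theorem kern_nonneg (β z : ℝ) : 0 ≤ kern β z :=
  indicator_nonneg (fun _ hx => Real.rpow_nonneg (le_of_lt hx) β) z

theorem measurable_kern (β : ℝ) : Measurable (kern β) :=
  (measurable_id.pow_const β).indicator measurableSet_Ioi

theorem kern_mul (β : ℝ) {h : ℝ} (hh : 0 < h) (z : ℝ) : kern β (h * z) = h ^ β * kern β z := by
  rcases lt_or_ge 0 z with hz | hz
  · rw [kern_of_pos _ hz, kern_of_pos _ (mul_pos hh hz), Real.mul_rpow hh.le hz.le]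
  · rw [kern_of_nonpos _ hz, kern_of_nonpos _ (mul_nonpos_of_nonneg_of_nonpos hh.le hz), mul_zero]

theorem intervalIntegrable_kern {β : ℝ} (hβ : -1 < β) (a b : ℝ) :
    IntervalIntegrable (kern β) volume a b := by
  have h : IntervalIntegrable (fun z : ℝ => z ^ β) volume a b :=
    intervalIntegral.intervalIntegrable_rpow' hβ
  rw [intervalIntegrable_iff] at h ⊢
  exact h.indicator measurableSet_Ioi

theorem intervalIntegrable_kern_sub {β : ℝ} (hβ : -1 < β) (t a b : ℝ) :
    IntervalIntegrable (fun x => kern β (t - x)) volume a b := by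
  simpa using (intervalIntegrable_kern hβ (t - a) (t - b)).comp_sub_left t

/-- Products of the kernel and a continuous function are integrable. -/
theorem intervalIntegrable_kern_sub_smul {V : Type*} [NormedAddCommGroup V] [NormedSpace ℝ V]
    {β : ℝ} (hβ : -1 < β) (t : ℝ) {a b : ℝ} {g : ℝ → V} (hg : ContinuousOn g (uIcc a b)) :
    IntervalIntegrable (fun x => kern β (t - x) • g x) volume a b :=
  (intervalIntegrable_kern_sub hβ t a b).smul_continuousOn hg

theorem integral_kern {α : ℝ} (hα : 0 < α) (d : ℝ) :
    ∫ z in (0 : ℝ)..d, kern (α - 1) z = max d 0 ^ α / α := by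
  rcases le_total 0 d with hd | hd
  · rw [max_eq_left hd]
    have : ∫ z in (0 : ℝ)..d, kern (α - 1) z = ∫ z in (0 : ℝ)..d, z ^ (α - 1) := by
      refine intervalIntegral.integral_congr_ae (Filter.Eventually.of_forall fun z hz => ?_)
      rw [uIoc_of_le hd] at hz
      exact kern_of_pos _ hz.1
    rw [this, integral_rpow (Or.inl (by linarith)), sub_add_cancel, Real.zero_rpow hα.ne', sub_zero]
  · rw [max_eq_right hd, Real.zero_rpow hα.ne', zero_div]
    refine intervalIntegral.integral_zero_ae (Filter.Eventually.of_forall fun z hz => ?_)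
    rw [uIoc_of_ge hd] at hz
    exact kern_of_nonpos _ hz.2

/-- The mass of the kernel on an interval is largest if the interval ends at `t`; this is the
subadditivity of `z ↦ z^α`. -/
theorem integral_kern_sub_le {α : ℝ} (hα : 0 < α) (hα1 : α ≤ 1) (t : ℝ) {a b : ℝ} (hab : a ≤ b) :
    ∫ x in a..b, kern (α - 1) (t - x) ≤ (b - a) ^ α / α := by
  have hk := intervalIntegrable_kern (β := α - 1) (by linarith)
  rw [intervalIntegral.integral_comp_sub_left (kern (α - 1)) t,
    ← intervalIntegral.integral_interval_sub_left (hk 0 _) (hk 0 _), integral_kern hα,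
    integral_kern hα, ← sub_div]
  gcongr
  have h1 : max (t - a) 0 ≤ max (t - b) 0 + (b - a) := by
    rcases max_cases (t - a) 0 with h | h <;> rcases max_cases (t - b) 0 with h' | h' <;> linarith
  have h2 := Real.rpow_le_rpow (le_max_right _ _) h1 hα.le
  have h3 := Real.rpow_add_le_add_rpow (le_max_right (t - b) 0) (sub_nonneg.2 hab) hα.le hα1
  linarith

/-- Truncation lets an integral against the kernel run beyond `t`. -/
theorem integral_kern_sub_smul_of_le {V : Type*} [NormedAddCommGroup V] [NormedSpace ℝ V]
    {β : ℝ} (hβ : -1 < β) {a t b : ℝ} (hat : a ≤ t) (htb : t ≤ b) {g : ℝ → V}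
    (hg : ContinuousOn g (Icc a b)) :
    ∫ x in a..b, kern β (t - x) • g x = ∫ x in a..t, (t - x) ^ β • g x := by
  have h1 : ∫ x in t..b, kern β (t - x) • g x = 0 := by
    refine intervalIntegral.integral_zero_ae (Filter.Eventually.of_forall fun z hz => ?_)
    rw [uIoc_of_le htb] at hz
    rw [kern_of_nonpos _ (by linarith [hz.1]), zero_smul]
  rw [← intervalIntegral.integral_add_adjacent_intervals (b := t), h1, add_zero]
  · refine intervalIntegral.integral_congr_Ioo_of_le hat fun x hx => ?_
    rw [kern_of_pos _ (by linarith [hx.2])]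
  · exact intervalIntegrable_kern_sub_smul hβ t (hg.mono (by
      rw [uIcc_of_le hat]; exact Icc_subset_Icc_right htb))
  · exact intervalIntegrable_kern_sub_smul hβ t (hg.mono (by
      rw [uIcc_of_le htb]; exact Icc_subset_Icc_left hat))

/-- The exponential weight makes the Riemann-Liouville integral a small operator. -/
theorem integral_kern_sub_mul_exp_le {α : ℝ} (hα : 0 < α) {lam : ℝ} (hlam : 0 < lam) {t : ℝ}
    (ht : 0 ≤ t) :
    ∫ x in (0 : ℝ)..t, kern (α - 1) (t - x) * Real.exp (lam * x) ≤
      Real.exp (lam * t) * ((1 / lam) ^ α * Real.Gamma α) := by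
  have h1 : ∀ x, kern (α - 1) (t - x) * Real.exp (lam * x) =
      Real.exp (lam * t) * (fun z => kern (α - 1) z * Real.exp (-(lam * z))) (t - x) := by
    intro x
    have : Real.exp (lam * x) = Real.exp (lam * t) * Real.exp (-(lam * (t - x))) := by
      rw [← Real.exp_add]; ring_nf
    simp only [this]; ring
  simp_rw [h1]
  rw [intervalIntegral.integral_const_mul,
    intervalIntegral.integral_comp_sub_left (fun z => kern (α - 1) z * Real.exp (-(lam * z))) t,
    sub_self, sub_zero]
  refine mul_le_mul_of_nonneg_left ?_ (Real.exp_pos _).le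
  rw [← Real.integral_rpow_mul_exp_neg_mul_Ioi hα hlam, intervalIntegral.integral_of_le ht]
  have hpos : 0 < (1 / lam) ^ α * Real.Gamma α := by
    have := Real.Gamma_pos_of_pos hα
    positivity
  have hint : IntegrableOn (fun z : ℝ => z ^ (α - 1) * Real.exp (-(lam * z))) (Ioi 0) := by
    by_contra hcon
    rw [← Real.integral_rpow_mul_exp_neg_mul_Ioi hα hlam, integral_undef hcon] at hpos
    exact lt_irrefl _ hpos
  rw [setIntegral_congr_fun measurableSet_Ioc (g := fun z => z ^ (α - 1) * Real.exp (-(lam * z)))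
    (fun z hz => by simp only [kern_of_pos _ hz.1])]
  refine setIntegral_mono_set hint ?_ (Filter.Eventually.of_forall fun z hz => hz.1)
  filter_upwards [ae_restrict_mem measurableSet_Ioi] with z hz
  exact mul_nonneg (Real.rpow_nonneg (le_of_lt hz) _) (Real.exp_pos _).le

/-- The two Abel kernels of orders `α` and `1 - α` convolve to a constant on `x < t`. -/
theorem integral_kern_mul_kern {α : ℝ} (hα : 0 < α) (hα1 : α < 1) {x t : ℝ} (hxt : x < t) :
    ∫ u in x..t, kern (α - 1) (t - u) * kern (-α) (u - x) =
      Real.Gamma α * Real.Gamma (1 - α) := by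
  have h1 : ∫ u in x..t, kern (α - 1) (t - u) * kern (-α) (u - x) =
      ∫ z in (0 : ℝ)..(t - x), z ^ (-α) * ((t - x) - z) ^ (α - 1) := by
    have := intervalIntegral.integral_comp_sub_right (a := x) (b := t)
      (fun z => z ^ (-α) * ((t - x) - z) ^ (α - 1)) x
    rw [sub_self] at this
    rw [← this]
    refine intervalIntegral.integral_congr_Ioo_of_le hxt.le fun u hu => ?_
    rw [kern_of_pos _ (by linarith [hu.2]), kern_of_pos _ (by linarith [hu.1]), mul_comm]
    ring_nf
  have h2 := Complex.betaIntegral_scaled ((1 - α : ℝ) : ℂ) (α : ℂ) (sub_pos.2 hxt)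
  rw [Complex.betaIntegral_eq_Gamma_mul_div _ _ (by simpa using hα1) (by simpa using hα)] at h2
  have h3 : ((1 - α : ℝ) : ℂ) + α = 1 := by push_cast; ring
  rw [h3, Complex.Gamma_one, div_one, sub_self, Complex.cpow_zero, one_mul, Complex.Gamma_ofReal,
    Complex.Gamma_ofReal] at h2
  have h4 : ∫ z in (0 : ℝ)..(t - x), (z : ℂ) ^ (((1 - α : ℝ) : ℂ) - 1) *
      (((t - x : ℝ) : ℂ) - z) ^ ((α : ℂ) - 1) =
      ((∫ z in (0 : ℝ)..(t - x), z ^ (-α) * ((t - x) - z) ^ (α - 1) : ℝ) : ℂ) := by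
    rw [← intervalIntegral.integral_ofReal]
    refine intervalIntegral.integral_congr_Ioo_of_le (sub_pos.2 hxt).le fun z hz => ?_
    rw [Complex.ofReal_mul, Complex.ofReal_cpow hz.1.le, Complex.ofReal_cpow (by linarith [hz.2])]
    push_cast
    congr 2
    ring
  rw [h4] at h2
  rw [h1, mul_comm]
  exact_mod_cast h2

/-! ### Riemann-Liouville integrals of the Jacobi polynomials -/

/-- The integral `∫_0^1 (X-τ)₊^(α-1) P_j(τ) dτ`, which is `J_j^α(X)` for `X ≥ 1`, is
`Γ(α) I^α P_j(X)` for `X ∈ [0,1]`, and vanishes for `X ≤ 0`. -/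
def stepKernel (α : ℝ) (j : ℕ) (X : ℝ) : ℝ :=
  ∫ τ in (0 : ℝ)..1, kern (α - 1) (X - τ) * (P α j).eval τ

/-- Convolution of an integrable kernel and a truncated continuous function is continuous: the
integrand is continuous in `X` except where `X - z` is an end of the truncation interval. -/
theorem continuous_integral_kern_sub_mul {β : ℝ} (hβ : -1 < β) {p : ℝ → ℝ} (hp : Continuous p) :
    Continuous fun X => ∫ τ in (0 : ℝ)..1, kern β (X - τ) * p τ := by
  obtain ⟨B, hB⟩ := isCompact_Icc.exists_bound_of_continuousOn (s := Icc (0 : ℝ) 1)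
    hp.continuousOn
  set g : ℝ → ℝ := (Ioc (0 : ℝ) 1).indicator p with hg
  have hB0 : 0 ≤ B := (norm_nonneg _).trans (hB 0 (by simp))
  have hgm : Measurable g := hp.measurable.indicator measurableSet_Ioc
  have hrw : (fun X => ∫ τ in (0 : ℝ)..1, kern β (X - τ) * p τ) =
      fun X => ∫ z, kern β z * g (X - z) := by
    funext X
    rw [intervalIntegral.integral_of_le zero_le_one, ← integral_indicator measurableSet_Ioc,
      ← integral_sub_left_eq_self (fun z => kern β z * g (X - z)) volume X]
    refine integral_congr_ae (Filter.Eventually.of_forall fun τ => ?_)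
    simp only [sub_sub_cancel, hg, indicator]
    split_ifs <;> simp
  rw [hrw, continuous_iff_continuousAt]
  intro X₀
  refine continuousAt_of_dominated
    (bound := (Ioc 0 (max 0 (X₀ + 1))).indicator fun z => kern β z * B) ?_ ?_ ?_ ?_
  · exact Filter.Eventually.of_forall fun X =>
      ((measurable_kern β).mul (hgm.comp (measurable_const.sub measurable_id))).aestronglyMeasurable
  · filter_upwards [Iio_mem_nhds (lt_add_one X₀)] with X hX
    refine Filter.Eventually.of_forall fun z => ?_
    rw [norm_mul, Real.norm_of_nonneg (kern_nonneg _ _)]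
    by_cases hz : z ∈ Ioc 0 (max 0 (X₀ + 1))
    · rw [indicator_of_mem hz]
      refine mul_le_mul_of_nonneg_left ?_ (kern_nonneg _ _)
      by_cases hx : X - z ∈ Ioc (0 : ℝ) 1
      · rw [hg, indicator_of_mem hx]
        exact hB _ (Ioc_subset_Icc_self hx)
      · rw [hg, indicator_of_notMem hx, norm_zero]
        exact hB0
    · rw [indicator_of_notMem hz]
      refine le_of_eq ?_
      rcases le_or_gt z 0 with h0 | h0
      · rw [kern_of_nonpos _ h0, zero_mul]
      · have h1 : X₀ + 1 < z := by
          by_contra hcon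
          exact hz ⟨h0, (not_lt.1 hcon).trans (le_max_right _ _)⟩
        rw [hg, indicator_of_notMem, norm_zero, mul_zero]
        intro h
        have := h.1
        have := mem_Iio.1 hX
        linarith
  · rw [integrable_indicator_iff measurableSet_Ioc,
      ← intervalIntegrable_iff_integrableOn_Ioc_of_le (le_max_left _ _)]
    exact (intervalIntegrable_kern hβ _ _).mul_const B
  · have hne : ∀ w : ℝ, ∀ᵐ z : ℝ, z ≠ w := fun w => Measure.ae_ne volume w
    filter_upwards [hne X₀, hne (X₀ - 1)] with z h0 h1
    refine continuousAt_const.mul ?_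
    have hga : ContinuousAt g (X₀ - z) := by
      rcases lt_or_gt_of_ne h0 with h0 | h0
      · rcases lt_or_gt_of_ne h1 with h1 | h1
        · have : g =ᶠ[nhds (X₀ - z)] fun _ => 0 := by
            filter_upwards [Ioi_mem_nhds (show 1 < X₀ - z by linarith)] with w hw
            exact indicator_of_notMem (fun h => absurd h.2 (not_le.2 hw)) _
          exact continuousAt_const.congr this.symm
        · have : g =ᶠ[nhds (X₀ - z)] p := by
            filter_upwards [Ioo_mem_nhds (show 0 < X₀ - z by linarith)
              (show X₀ - z < 1 by linarith)] with w hw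
            exact indicator_of_mem (Ioo_subset_Ioc_self hw) _
          exact hp.continuousAt.congr this.symm
      · have : g =ᶠ[nhds (X₀ - z)] fun _ => 0 := by
          filter_upwards [Iio_mem_nhds (show X₀ - z < 0 by linarith)] with w hw
          exact indicator_of_notMem (fun h => absurd h.1 (not_lt.2 (le_of_lt hw))) _
        exact continuousAt_const.congr this.symm
    exact ContinuousAt.comp (f := fun X => X - z) hga (by fun_prop)

section StepKernel

variable {α : ℝ}

theorem continuous_stepKernel (hα : 0 < α) (j : ℕ) : Continuous (stepKernel α j) :=
  continuous_integral_kern_sub_mul (by linarith) (P α j).continuous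

theorem stepKernel_of_one_le (j : ℕ) {X : ℝ} (hX : 1 ≤ X) : stepKernel α j X = J α j X := by
  refine intervalIntegral.integral_congr_Ioo_of_le zero_le_one fun τ hτ => ?_
  rw [kern_of_pos _ (by linarith [hτ.2])]

theorem stepKernel_of_mem_Icc (hα : 0 < α) (j : ℕ) {X : ℝ} (hX : X ∈ Icc (0 : ℝ) 1) :
    stepKernel α j X = Real.Gamma α * IP α j X := by
  have hΓ := (Real.Gamma_pos_of_pos hα).ne'
  have := integral_kern_sub_smul_of_le (β := α - 1) (by linarith) hX.1 hX.2
    (P α j).continuous.continuousOn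
  simp only [smul_eq_mul] at this
  rw [stepKernel, this, IP, riemannLiouville]
  field_simp

theorem stepKernel_of_nonpos (j : ℕ) {X : ℝ} (hX : X ≤ 0) : stepKernel α j X = 0 := by
  refine (intervalIntegral.integral_congr_Ioo_of_le zero_le_one fun τ hτ => ?_).trans
    intervalIntegral.integral_zero
  rw [kern_of_nonpos _ (by linarith [hτ.1]), zero_mul]

theorem integral_kern_sub_mul_eval (j : ℕ) (t a : ℝ) {h : ℝ} (hh : 0 < h) :
    ∫ x in a..(a + h), kern (α - 1) (t - x) * (P α j).eval ((x - a) / h) =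
      h ^ α * stepKernel α j ((t - a) / h) := by
  have h1 := intervalIntegral.smul_integral_comp_mul_add (a := 0) (b := 1)
    (fun x => kern (α - 1) (t - x) * (P α j).eval ((x - a) / h)) h a
  rw [mul_zero, zero_add, mul_one, add_comm h a] at h1
  rw [← h1, stepKernel, smul_eq_mul, ← intervalIntegral.integral_const_mul,
    ← intervalIntegral.integral_const_mul]
  refine intervalIntegral.integral_congr fun τ _ => ?_
  have h2 : t - (h * τ + a) = h * ((t - a) / h - τ) := by field_simp; ring
  have h3 : (h * τ + a - a) / h = τ := by field_simp; ring
  have h4 : h ^ α = h * h ^ (α - 1) := by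
    rw [Real.rpow_sub_one hh.ne']; field_simp
  simp only [h2, h3, kern_mul _ hh, h4]
  ring

end StepKernel

/-! ### The equivalent Volterra equation -/

/-- Abel's inversion formula: the Riemann-Liouville integrals of orders `1 - α` and `α` compose,
up to the factor `Γ(α) Γ(1-α)`, to the integral. -/
theorem integral_kern_mul_integral_kern {α : ℝ} (hα : 0 < α) (hα1 : α < 1) {t : ℝ} (ht : 0 ≤ t)
    {φ : ℝ → ℝ} (hφ : IntervalIntegrable φ volume 0 t) :
    ∫ u in (0 : ℝ)..t, kern (α - 1) (t - u) * ∫ x in (0 : ℝ)..t, kern (-α) (u - x) * φ x =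
      Real.Gamma α * Real.Gamma (1 - α) * ∫ x in (0 : ℝ)..t, φ x := by
  set Q := Real.Gamma α * Real.Gamma (1 - α) with hQ
  have hQ0 : 0 < Q := mul_pos (Real.Gamma_pos_of_pos hα) (Real.Gamma_pos_of_pos (by linarith))
  set k : ℝ → ℝ → ℝ := fun u x => kern (α - 1) (t - u) * kern (-α) (u - x) with hk
  have hk0 : ∀ u x, 0 ≤ k u x := fun u x => mul_nonneg (kern_nonneg _ _) (kern_nonneg _ _)
  have hkmeas : Measurable (fun z : ℝ × ℝ => k z.1 z.2) :=
    ((measurable_kern _).comp (measurable_const.sub measurable_fst)).mul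
      ((measurable_kern _).comp (measurable_fst.sub measurable_snd))
  set μ : Measure ℝ := volume.restrict (Ioc 0 t) with hμ
  -- a nonzero integral forces integrability
  have hkint : ∀ x ∈ Ioo 0 t, Integrable (fun u => k u x) μ ∧ ∫ u, k u x ∂μ = Q := by
    intro x hx
    have h1 : (fun u => k u x) =ᵐ[μ] (Ioc x t).indicator (fun u => k u x) := by
      refine Filter.Eventually.of_forall fun u => ?_
      by_cases hu : u ∈ Ioc x t
      · simp only [indicator_of_mem hu]
      · simp only [indicator_of_notMem hu, hk]
        rcases le_or_gt u x with h | h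
        · rw [kern_of_nonpos (-α) (by linarith), mul_zero]
        · have : t < u := by
            by_contra hcon
            exact hu ⟨h, not_lt.1 hcon⟩
          rw [kern_of_nonpos (α - 1) (by linarith), zero_mul]
    have h2 : ∫ u, k u x ∂μ = Q := by
      rw [integral_congr_ae h1, setIntegral_indicator measurableSet_Ioc, Ioc_inter_Ioc,
        max_eq_right hx.1.le, min_self, ← intervalIntegral.integral_of_le hx.2.le]
      exact integral_kern_mul_kern hα hα1 hx.2
    refine ⟨?_, h2⟩
    by_contra hcon
    rw [integral_undef hcon] at h2
    exact hQ0.ne h2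
  have hmem : ∀ᵐ x ∂μ, x ∈ Ioo 0 t := by
    rw [hμ, ← restrict_Ioo_eq_restrict_Ioc]
    exact ae_restrict_mem measurableSet_Ioo
  have hφ' : Integrable φ μ := (intervalIntegrable_iff_integrableOn_Ioc_of_le ht).1 hφ
  have hF : Integrable (Function.uncurry fun u x => k u x * φ x) (μ.prod μ) := by
    have hm : AEStronglyMeasurable (Function.uncurry fun u x => k u x * φ x) (μ.prod μ) :=
      hkmeas.aestronglyMeasurable.mul hφ'.aestronglyMeasurable.comp_snd
    rw [integrable_prod_iff' hm]
    refine ⟨?_, ?_⟩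
    · filter_upwards [hmem] with x hx
      exact (hkint x hx).1.mul_const (φ x)
    · refine (hφ'.norm.const_mul Q).congr ?_
      filter_upwards [hmem] with x hx
      simp only [Function.uncurry, norm_mul, Real.norm_of_nonneg (hk0 _ _)]
      rw [integral_mul_const, (hkint x hx).2]
  have hswap := integral_integral_swap hF
  simp only [intervalIntegral.integral_of_le ht, ← integral_const_mul]
  rw [← hμ]
  simp only [hk, mul_assoc] at hswap ⊢
  rw [hswap]
  refine integral_congr_ae ?_
  filter_upwards [hmem] with x hx
  simp only [← mul_assoc]
  rw [integral_mul_const]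
  have := (hkint x hx).2
  simp only [hk] at this
  rw [this]

/-- Coordinates of an absolutely continuous curve are absolutely continuous. -/
theorem absolutelyContinuousOnInterval_coord {m : ℕ} {y : ℝ → EuclideanSpace ℝ (Fin m)} {a b : ℝ}
    (hy : AbsolutelyContinuousOnInterval y a b) (i : Fin m) :
    AbsolutelyContinuousOnInterval (fun x => y x i) a b := by
  refine squeeze_zero (fun E => Finset.sum_nonneg fun _ _ => dist_nonneg) (fun E => ?_) hy
  refine Finset.sum_le_sum fun j _ => ?_
  rw [dist_eq_norm, dist_eq_norm, ← PiLp.sub_apply]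
  exact PiLp.norm_apply_le _ i

theorem ae_deriv_coord {m : ℕ} {y : ℝ → EuclideanSpace ℝ (Fin m)} {T : ℝ}
    (hy : AbsolutelyContinuousOnInterval y 0 T) (hT : 0 ≤ T) (i : Fin m) :
    ∀ᵐ x ∂volume.restrict (Ioo 0 T), deriv y x i = deriv (fun x => y x i) x := by
  have h := hy.boundedVariationOn.locallyBoundedVariationOn.ae_differentiableWithinAt
    measurableSet_uIcc
  rw [uIcc_of_le hT] at h
  filter_upwards [ae_restrict_of_ae_restrict_of_subset Ioo_subset_Icc_self h,
    ae_restrict_mem measurableSet_Ioo] with x hx hmem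
  have hd : DifferentiableAt ℝ y x := hx.differentiableAt (Icc_mem_nhds hmem.1 hmem.2)
  exact (((EuclideanSpace.proj (𝕜 := ℝ) i).hasFDerivAt.comp_hasDerivAt x
    hd.hasDerivAt).deriv).symm

theorem integral_coord {m : ℕ} {g : ℝ → EuclideanSpace ℝ (Fin m)} {a b : ℝ}
    (hg : IntervalIntegrable g volume a b) (i : Fin m) :
    (∫ x in a..b, g x) i = ∫ x in a..b, g x i :=
  ((EuclideanSpace.proj (𝕜 := ℝ) i).intervalIntegral_comp_comm hg).symm

/-- A solution of the fractional initial value problem solves the Volterra integral equation. -/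
theorem IsFracSolution.eq_add_integral {m : ℕ} {α T : ℝ} (hα : 0 < α) (hα1 : α ≤ 1) (hT : 0 < T)
    {f : EuclideanSpace ℝ (Fin m) → EuclideanSpace ℝ (Fin m)} {y₀ : EuclideanSpace ℝ (Fin m)}
    {y : ℝ → EuclideanSpace ℝ (Fin m)} (hy : IsFracSolution α T f y₀ y)
    (hf : ContinuousOn (fun x => f (y x)) (Icc 0 T)) {t : ℝ} (ht : t ∈ Icc 0 T) :
    y t = y₀ + (1 / Real.Gamma α) • ∫ x in (0 : ℝ)..t, kern (α - 1) (t - x) • f (y x) := by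
  have hyc : ContinuousOn y (Icc 0 T) := by simpa [uIcc_of_le hT.le] using hy.absCont.continuousOn
  have hft : ContinuousOn (fun x => f (y x)) (uIcc 0 t) := hf.mono (by
    rw [uIcc_of_le ht.1]; exact Icc_subset_Icc_right ht.2)
  rcases hα1.lt_or_eq with hα1 | rfl
  · have hΓ := (Real.Gamma_pos_of_pos hα).ne'
    have hΓ' := (Real.Gamma_pos_of_pos (show 0 < 1 - α by linarith)).ne'
    have hint := intervalIntegrable_kern_sub_smul (β := α - 1) (by linarith) t hft
    ext i
    set φ : ℝ → ℝ := deriv fun x => y x i with hφ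
    have hac := absolutelyContinuousOnInterval_coord
      (hy.absCont.mono (c := 0) (d := t) (by
        rw [uIcc_of_le ht.1, uIcc_of_le hT.le]; exact Icc_subset_Icc_right ht.2)) i
    have hftc := hac.integral_deriv_eq_sub
    have hcaputo : ∀ u ∈ Ioo 0 t,
        ∫ x in (0 : ℝ)..t, kern (-α) (u - x) * φ x = Real.Gamma (1 - α) * f (y u) i := by
      intro u hu
      obtain ⟨h1, h2⟩ := (hy.eqn u ⟨hu.1, hu.2.le.trans ht.2⟩).1 hα1
      have h3 : ∫ x in (0 : ℝ)..t, kern (-α) (u - x) * φ x =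
          ∫ x in (0 : ℝ)..u, kern (-α) (u - x) * φ x := by
        rw [intervalIntegral.integral_of_le ht.1, intervalIntegral.integral_of_le hu.1.le]
        refine setIntegral_eq_of_subset_of_forall_sdiff_eq_zero measurableSet_Ioc
          (Ioc_subset_Ioc_right hu.2.le) fun x hx => ?_
        have : u ≤ x := by
          by_contra hcon
          exact hx.2 ⟨hx.1.1, (not_le.1 hcon).le⟩
        rw [kern_of_nonpos _ (by linarith), zero_mul]
      have h4 : ∫ x in (0 : ℝ)..u, kern (-α) (u - x) * φ x =
          ∫ x in (0 : ℝ)..u, ((u - x) ^ (-α) • deriv y x) i := by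
        rw [intervalIntegral.integral_of_le hu.1.le, intervalIntegral.integral_of_le hu.1.le,
          ← restrict_Ioo_eq_restrict_Ioc]
        refine integral_congr_ae ?_
        have h5 := ae_restrict_of_ae_restrict_of_subset
          (Ioo_subset_Ioo_right (hu.2.le.trans ht.2)) (ae_deriv_coord hy.absCont hT.le i)
        filter_upwards [h5, ae_restrict_mem measurableSet_Ioo] with x hx hmem
        rw [PiLp.smul_apply, hx, smul_eq_mul, kern_of_pos _ (by linarith [hmem.2])]
      rw [h3, h4, ← integral_coord h1, ← h2, PiLp.smul_apply, smul_eq_mul]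
      field_simp
    have habel := integral_kern_mul_integral_kern hα hα1 ht.1
      (hac.intervalIntegrable_deriv)
    rw [hftc, hy.init] at habel
    have h6 : ∫ u in (0 : ℝ)..t, kern (α - 1) (t - u) *
        ∫ x in (0 : ℝ)..t, kern (-α) (u - x) * φ x =
        Real.Gamma (1 - α) * ∫ u in (0 : ℝ)..t, (kern (α - 1) (t - u) • f (y u)) i := by
      rw [← intervalIntegral.integral_const_mul]
      refine intervalIntegral.integral_congr_Ioo_of_le ht.1 fun u hu => ?_
      rw [hcaputo u hu, PiLp.smul_apply, smul_eq_mul]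
      ring
    rw [h6] at habel
    rw [PiLp.add_apply, PiLp.smul_apply, integral_coord hint, smul_eq_mul]
    have h7 : Real.Gamma α * (y t i - y₀ i) =
        ∫ u in (0 : ℝ)..t, (kern (α - 1) (t - u) • f (y u)) i := by
      apply mul_left_cancel₀ hΓ'
      rw [habel]; ring
    rw [← h7]
    field_simp
    ring
  · have h1 : ∫ x in (0 : ℝ)..t, kern (1 - 1) (t - x) • f (y x) = ∫ x in (0 : ℝ)..t, f (y x) := by
      refine intervalIntegral.integral_congr_Ioo_of_le ht.1 fun x hx => ?_
      rw [kern_of_pos _ (by linarith [hx.2]), sub_self, Real.rpow_zero, one_smul]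
    have h2 : ∫ x in (0 : ℝ)..t, f (y x) = y t - y 0 := by
      refine intervalIntegral.integral_eq_sub_of_hasDerivAt_of_le ht.1
        (hyc.mono (Icc_subset_Icc_right ht.2)) (fun x hx => ?_) hft.intervalIntegrable
      exact ((hy.eqn x ⟨hx.1, hx.2.le.trans ht.2⟩).2 rfl).hasDerivAt
        (Icc_mem_nhds hx.1 (hx.2.trans_le ht.2))
    rw [h1, h2, Real.Gamma_one, hy.init]
    simp

/-! ### A fractional Gronwall inequality -/

/-- The amplification factor of the fractional Gronwall inequality over `[0,t]`. -/
def growth (α L t : ℝ) : ℝ := 2 * Real.exp ((2 * L + 1) ^ (1 / α) * t)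

theorem growth_pos (α L t : ℝ) : 0 < growth α L t := mul_pos two_pos (Real.exp_pos _)

theorem growth_mono {α L t t' : ℝ} (hL : 0 ≤ L) (h : t ≤ t') : growth α L t ≤ growth α L t' := by
  unfold growth
  gcongr

/-- Fractional Gronwall inequality. At a maximum of `e^(-λt) u(t)` the choice
`λ = (2L+1)^(1/α)` allows the integral term to absorb at most half of the maximum. -/
theorem le_mul_growth {α L t₁ A : ℝ} (hα : 0 < α) (hL : 0 ≤ L) {u : ℝ → ℝ}
    (hu : ContinuousOn u (Icc 0 t₁)) (hu0 : ∀ t ∈ Icc 0 t₁, 0 ≤ u t)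
    (h : ∀ t ∈ Icc 0 t₁,
      u t ≤ A + L / Real.Gamma α * ∫ x in (0 : ℝ)..t, kern (α - 1) (t - x) * u x) :
    ∀ t ∈ Icc 0 t₁, u t ≤ A * growth α L t := by
  intro t ht
  set lam : ℝ := (2 * L + 1) ^ (1 / α) with hlam
  have hlam0 : 0 < lam := Real.rpow_pos_of_pos (by linarith) _
  have hlamα : (1 / lam) ^ α = 1 / (2 * L + 1) := by
    rw [Real.div_rpow zero_le_one hlam0.le, Real.one_rpow, hlam, ← Real.rpow_mul (by linarith),
      one_div_mul_cancel hα.ne', Real.rpow_one]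
  have hΓ := Real.Gamma_pos_of_pos hα
  have ht1 : (0 : ℝ) ≤ t₁ := ht.1.trans ht.2
  have hA : 0 ≤ A := by
    have h0 : (0 : ℝ) ∈ Icc 0 t₁ := ⟨le_rfl, ht1⟩
    have := h 0 h0
    rw [intervalIntegral.integral_same, mul_zero, add_zero] at this
    exact (hu0 0 h0).trans this
  obtain ⟨t₀, ht₀, hmax⟩ := isCompact_Icc.exists_isMaxOn (nonempty_Icc.2 ht1)
    (f := fun t => Real.exp (-(lam * t)) * u t)
    (ContinuousOn.mul (by fun_prop) hu)
  set E := Real.exp (-(lam * t₀)) * u t₀ with hE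
  have hE0 : 0 ≤ E := mul_nonneg (Real.exp_pos _).le (hu0 _ ht₀)
  have hle : ∀ x ∈ Icc 0 t₁, u x ≤ E * Real.exp (lam * x) := by
    intro x hx
    have h1 : Real.exp (-(lam * x)) * u x ≤ E := hmax hx
    calc u x = Real.exp (-(lam * x)) * u x * Real.exp (lam * x) := by
          rw [mul_right_comm, ← Real.exp_add]; simp
      _ ≤ E * Real.exp (lam * x) := by gcongr
  have hint : ∫ x in (0 : ℝ)..t₀, kern (α - 1) (t₀ - x) * u x ≤
      E * (Real.exp (lam * t₀) * ((1 / lam) ^ α * Real.Gamma α)) := by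
    have hsub : uIcc 0 t₀ ⊆ Icc 0 t₁ := by
      rw [uIcc_of_le ht₀.1]; exact Icc_subset_Icc_right ht₀.2
    calc ∫ x in (0 : ℝ)..t₀, kern (α - 1) (t₀ - x) * u x
        ≤ ∫ x in (0 : ℝ)..t₀, E * (kern (α - 1) (t₀ - x) * Real.exp (lam * x)) := by
          refine intervalIntegral.integral_mono_on ht₀.1
            (intervalIntegrable_kern_sub_smul (by linarith) _ (hu.mono hsub))
            ((intervalIntegrable_kern_sub_smul (g := fun x => Real.exp (lam * x)) (by linarith) _
              (by fun_prop)).const_mul E) fun x hx => ?_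
          have := mul_le_mul_of_nonneg_left (hle x ⟨hx.1, hx.2.trans ht₀.2⟩)
            (kern_nonneg (α - 1) (t₀ - x))
          linarith
      _ ≤ _ := by
          rw [intervalIntegral.integral_const_mul]
          exact mul_le_mul_of_nonneg_left (integral_kern_sub_mul_exp_le hα hlam0 ht₀.1) hE0
  have hE2 : E ≤ 2 * A := by
    have h1 := h t₀ ht₀
    have h2 : L / Real.Gamma α * ∫ x in (0 : ℝ)..t₀, kern (α - 1) (t₀ - x) * u x ≤
        E * Real.exp (lam * t₀) * (L / (2 * L + 1)) := by
      refine (mul_le_mul_of_nonneg_left hint (by positivity)).trans (le_of_eq ?_)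
      rw [hlamα]
      field_simp
    have h3 : L / (2 * L + 1) ≤ 1 / 2 := by
      rw [div_le_div_iff₀ (by linarith) two_pos]; linarith
    have h4 : u t₀ = E * Real.exp (lam * t₀) := by
      rw [hE, mul_right_comm, ← Real.exp_add]; simp
    have h5 : 1 ≤ Real.exp (lam * t₀) := Real.one_le_exp (mul_nonneg hlam0.le ht₀.1)
    have h6 : E * Real.exp (lam * t₀) * (L / (2 * L + 1)) ≤
        E * Real.exp (lam * t₀) * (1 / 2) := by gcongr
    have h7 : E * 1 ≤ E * Real.exp (lam * t₀) := by gcongr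
    linarith
  calc u t ≤ E * Real.exp (lam * t) := hle t ht
    _ ≤ 2 * A * Real.exp (lam * t) := by gcongr
    _ = A * growth α L t := by rw [growth]; ring

/-- A continuity argument: if the Gronwall inequality is known up to `t` only as long as `u < δ`
before `t`, and the bound it gives stays below `δ`, then the bound holds throughout. -/
theorem le_mul_growth_of_lt {α L t₁ A δ : ℝ} (hα : 0 < α) (hL : 0 ≤ L) {u : ℝ → ℝ}
    (hu : ContinuousOn u (Icc 0 t₁)) (hu0 : ∀ t ∈ Icc 0 t₁, 0 ≤ u t) (hA : 0 ≤ A)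
    (hδ : A * growth α L t₁ < δ)
    (h : ∀ t ∈ Icc 0 t₁, (∀ x ∈ Ico 0 t, u x < δ) →
      u t ≤ A + L / Real.Gamma α * ∫ x in (0 : ℝ)..t, kern (α - 1) (t - x) * u x) :
    ∀ t ∈ Icc 0 t₁, u t ≤ A * growth α L t₁ := by
  have key : ∀ t₂ ∈ Icc 0 t₁, (∀ x ∈ Ico 0 t₂, u x < δ) →
      ∀ t ∈ Icc 0 t₂, u t ≤ A * growth α L t₁ := by
    intro t₂ ht₂ hx t ht
    have hsub : Icc 0 t₂ ⊆ Icc 0 t₁ := Icc_subset_Icc_right ht₂.2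
    refine (le_mul_growth hα hL (hu.mono hsub) (fun t ht => hu0 t (hsub ht)) (fun t ht =>
      h t (hsub ht) fun x hxt => hx x ⟨hxt.1, hxt.2.trans_le ht.2⟩) t ht).trans ?_
    exact mul_le_mul_of_nonneg_left (growth_mono hL (hsub ht).2) hA
  suffices hlt : ∀ t ∈ Icc 0 t₁, u t < δ by
    intro t ht
    exact key t₁ ⟨ht.1.trans ht.2, le_rfl⟩ (fun x hx => hlt x ⟨hx.1, hx.2.le⟩) t ht
  by_contra! hcon
  have hcpt : IsCompact {t ∈ Icc 0 t₁ | δ ≤ u t} :=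
    isCompact_Icc.of_isClosed_subset
      (hu.preimage_isClosed_of_isClosed isClosed_Icc isClosed_Ici) (fun t ht => ht.1)
  obtain ⟨t₂, ht₂, hmin⟩ := hcpt.exists_isLeast hcon
  have := key t₂ ht₂.1 (fun x hx => by
    by_contra! hxδ
    exact absurd (hmin ⟨⟨hx.1, hx.2.le.trans ht₂.1.2⟩, hxδ⟩) (not_le.2 hx.2)) t₂
    ⟨ht₂.1.1, le_rfl⟩
  linarith [ht₂.2]

/-! ### Meshes -/

theorem step_pos {r h₁ : ℝ} (hr : 0 < r) (hh : 0 < h₁) (n : ℕ) : 0 < step r h₁ n :=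
  mul_pos (pow_pos hr _) hh

theorem step_succ (r h₁ : ℝ) (n : ℕ) : step r h₁ (n + 1) = r ^ n * h₁ := rfl

theorem step_mono {r h₁ : ℝ} (hr : 1 ≤ r) (hh : 0 < h₁) {m n : ℕ} (hmn : m ≤ n) :
    step r h₁ m ≤ step r h₁ n :=
  mul_le_mul_of_nonneg_right (pow_le_pow_right₀ hr (by omega)) hh.le

theorem meshPoint_zero (r h₁ : ℝ) : meshPoint r h₁ 0 = 0 := by simp [meshPoint]

theorem meshPoint_succ (r h₁ : ℝ) (n : ℕ) :
    meshPoint r h₁ (n + 1) = meshPoint r h₁ n + step r h₁ (n + 1) :=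
  Finset.sum_Icc_succ_top (by omega) _

theorem meshPoint_mono {r h₁ : ℝ} (hr : 0 < r) (hh : 0 < h₁) : Monotone (meshPoint r h₁) :=
  monotone_nat_of_le_succ fun n => by
    rw [meshPoint_succ]; linarith [step_pos hr hh (n + 1)]

theorem meshPoint_nonneg {r h₁ : ℝ} (hr : 0 < r) (hh : 0 < h₁) (n : ℕ) : 0 ≤ meshPoint r h₁ n :=
  (meshPoint_zero r h₁).symm.le.trans (meshPoint_mono hr hh (Nat.zero_le n))

theorem meshPoint_add (r h₁ : ℝ) (k d : ℕ) :
    meshPoint r h₁ (k + d) =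
      meshPoint r h₁ k + step r h₁ (k + 1) * ∑ i ∈ Finset.range d, r ^ i := by
  induction d with
  | zero => simp
  | succ d ih =>
    rw [← add_assoc, meshPoint_succ, ih, Finset.sum_range_succ, step_succ, step_succ]
    ring

theorem sum_Icc_one_eq_sum_range {M : Type*} [AddCommMonoid M] (F : ℕ → M) (n : ℕ) :
    ∑ ν ∈ Finset.Icc 1 n, F ν = ∑ k ∈ Finset.range n, F (k + 1) := by
  induction n with
  | zero => simp
  | succ n ih => rw [Finset.sum_Icc_succ_top (by omega), ih, Finset.sum_range_succ]

/-! ### The approximation as one function of time -/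

section Global

variable {V : Type*} [NormedAddCommGroup V] [NormedSpace ℝ V]

/-- The piecewise quasi-polynomial approximation of the steps `1, ..., n` as a function of time:
`y₀ + I^α G`, where `G = ∑_j P_j γ_j^ν` on step `ν`. -/
def approx (α : ℝ) (s : ℕ) (r h₁ : ℝ) (y₀ : V) (γ : ℕ → ℕ → V) (n : ℕ) (t : ℝ) : V :=
  y₀ + (1 / Real.Gamma α) • ∑ ν ∈ Finset.Icc 1 n, (step r h₁ ν ^ α) •
    ∑ j ∈ Finset.range s,
      stepKernel α j ((t - meshPoint r h₁ (ν - 1)) / step r h₁ ν) • γ ν j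

theorem continuous_approx {α : ℝ} (hα : 0 < α) (s : ℕ) (r h₁ : ℝ) (y₀ : V) (γ : ℕ → ℕ → V)
    (n : ℕ) : Continuous (approx α s r h₁ y₀ γ n) := by
  unfold approx
  refine continuous_const.add (continuous_const.smul (continuous_finsetSum _ fun ν _ =>
    continuous_const.smul (continuous_finsetSum _ fun j _ => ?_)))
  exact ((continuous_stepKernel hα j).comp (by fun_prop)).smul continuous_const

theorem approx_eq_quasiPoly {α : ℝ} (hα : 0 < α) (s : ℕ) {r h₁ : ℝ} (hr : 0 < r) (hh : 0 < h₁)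
    (y₀ : V) (γ : ℕ → ℕ → V) {n ν : ℕ} (hν : ν ∈ Finset.Icc 1 n) {c : ℝ} (hc : c ∈ Icc (0 : ℝ) 1) :
    approx α s r h₁ y₀ γ n (meshPoint r h₁ (ν - 1) + c * step r h₁ ν) =
      quasiPoly α s r h₁ y₀ γ ν c := by
  obtain ⟨p, rfl⟩ : ∃ p, ν = p + 1 := ⟨ν - 1, by have := (Finset.mem_Icc.1 hν).1; omega⟩
  have hpn := (Finset.mem_Icc.1 hν).2
  set t := meshPoint r h₁ (p + 1 - 1) + c * step r h₁ (p + 1) with ht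
  have hΓ := (Real.Gamma_pos_of_pos hα).ne'
  have hsp := step_pos (n := p + 1) hr hh
  -- the steps after `ν` do not contribute at time `t`
  have h1 : ∑ μ ∈ Finset.Icc 1 n, (step r h₁ μ ^ α) • ∑ j ∈ Finset.range s,
        stepKernel α j ((t - meshPoint r h₁ (μ - 1)) / step r h₁ μ) • γ μ j =
      ∑ μ ∈ Finset.Icc 1 (p + 1), (step r h₁ μ ^ α) • ∑ j ∈ Finset.range s,
        stepKernel α j ((t - meshPoint r h₁ (μ - 1)) / step r h₁ μ) • γ μ j := by
    refine (Finset.sum_subset (Finset.Icc_subset_Icc_right hpn) fun μ hμ hμ' => ?_).symm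
    have hlt : p + 1 ≤ μ - 1 := by
      simp only [Finset.mem_Icc] at hμ hμ'; omega
    have hX : (t - meshPoint r h₁ (μ - 1)) / step r h₁ μ ≤ 0 := by
      refine div_nonpos_of_nonpos_of_nonneg ?_ (step_pos hr hh μ).le
      have h2 := meshPoint_mono hr hh hlt
      rw [meshPoint_succ] at h2
      have h3 : c * step r h₁ (p + 1) ≤ 1 * step r h₁ (p + 1) := by gcongr; exact hc.2
      rw [Nat.add_sub_cancel] at ht
      linarith
    simp [stepKernel_of_nonpos _ hX]
  rw [approx, h1, Finset.sum_Icc_succ_top (by omega), quasiPoly, history, smul_add, ← add_assoc,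
    Nat.add_sub_cancel]
  congr 1
  · congr 2
    refine Finset.sum_congr rfl fun μ hμ => ?_
    congr 1
    refine Finset.sum_congr rfl fun j _ => ?_
    obtain ⟨q, rfl⟩ : ∃ q, μ = q + 1 := ⟨μ - 1, by have := (Finset.mem_Icc.1 hμ).1; omega⟩
    obtain ⟨d, rfl⟩ : ∃ d, p = q + 1 + d :=
      ⟨p - (q + 1), by have := (Finset.mem_Icc.1 hμ).2; omega⟩
    have hsq := (step_pos (n := q + 1) hr hh).ne'
    have hX : (t - meshPoint r h₁ (q + 1 - 1)) / step r h₁ (q + 1) =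
        (∑ i ∈ Finset.range (q + 1 + d - (q + 1) + 1), r ^ i) +
          c * r ^ (q + 1 + d - (q + 1) + 1) := by
      rw [ht, Nat.add_sub_cancel, Nat.add_sub_cancel, Nat.add_sub_cancel_left,
        show q + 1 + d = q + (d + 1) by ring, meshPoint_add, step_succ r h₁ (q + (d + 1)), pow_add,
        step_succ]
      rw [step_succ] at hsq
      field_simp
      ring
    have hX1 : 1 ≤ (∑ i ∈ Finset.range (q + 1 + d - (q + 1) + 1), r ^ i) +
          c * r ^ (q + 1 + d - (q + 1) + 1) := by
      rw [Finset.sum_range_succ']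
      have h2 : 0 ≤ ∑ k ∈ Finset.range (q + 1 + d - (q + 1)), r ^ (k + 1) :=
        Finset.sum_nonneg fun k _ => by positivity
      have h3 : 0 ≤ c * r ^ (q + 1 + d - (q + 1) + 1) := mul_nonneg hc.1 (by positivity)
      rw [pow_zero]
      linarith
    rw [hX, stepKernel_of_one_le _ hX1]
  · have hX : (t - meshPoint r h₁ p) / step r h₁ (p + 1) = c := by
      rw [ht, Nat.add_sub_cancel]
      field_simp
      ring
    rw [hX, smul_comm, Finset.smul_sum]
    congr 1
    refine Finset.sum_congr rfl fun j _ => ?_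
    rw [stepKernel_of_mem_Icc hα _ hc, smul_smul]
    congr 1
    field_simp

theorem intervalIntegrable_kern_sub_smul_sum {α : ℝ} (hα : 0 < α) (s : ℕ) (t a b c h : ℝ)
    (g : ℕ → V) :
    IntervalIntegrable (fun x => kern (α - 1) (t - x) •
      ∑ j ∈ Finset.range s, (P α j).eval ((x - c) / h) • g j) volume a b := by
  refine intervalIntegrable_kern_sub_smul (by linarith) t (Continuous.continuousOn ?_)
  refine continuous_finsetSum _ fun j _ => Continuous.smul ?_ continuous_const
  exact (P α j).continuous.comp (by fun_prop)

/-- The approximation is a Riemann-Liouville integral, step by step. -/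
theorem approx_eq_sum_integral [CompleteSpace V] {α : ℝ} (hα : 0 < α) (s : ℕ) {r h₁ : ℝ}
    (hr : 0 < r) (hh : 0 < h₁) (y₀ : V) (γ : ℕ → ℕ → V) (n : ℕ) (t : ℝ) :
    approx α s r h₁ y₀ γ n t = y₀ + (1 / Real.Gamma α) • ∑ k ∈ Finset.range n,
      ∫ x in (meshPoint r h₁ k)..(meshPoint r h₁ (k + 1)), kern (α - 1) (t - x) •
        ∑ j ∈ Finset.range s,
          (P α j).eval ((x - meshPoint r h₁ k) / step r h₁ (k + 1)) • γ (k + 1) j := by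
  rw [approx, sum_Icc_one_eq_sum_range]
  congr 2
  refine Finset.sum_congr rfl fun k _ => ?_
  simp only [Nat.add_sub_cancel, Finset.smul_sum]
  rw [intervalIntegral.integral_finsetSum]
  · refine Finset.sum_congr rfl fun j _ => ?_
    simp only [smul_smul]
    rw [intervalIntegral.integral_smul_const, meshPoint_succ,
      integral_kern_sub_mul_eval _ _ _ (step_pos hr hh _)]
  · intro j _
    refine intervalIntegrable_kern_sub_smul (by linarith) t (Continuous.continuousOn ?_)
    exact Continuous.smul ((P α j).continuous.comp (by fun_prop)) continuous_const

/-! ### The error in terms of the defects -/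

/-- Errors from defects: if `f(σ_ν)` differs from `∑_j P_j γ_j^ν` by at most `D_ν`, the errors of
the steps `1, ..., n` are bounded by `∑_ν D_ν h_ν^α`, up to the Gronwall factor. -/
theorem norm_sub_quasiPoly_le [CompleteSpace V] {α : ℝ} (hα : 0 < α) (hα1 : α ≤ 1) {s n : ℕ}
    {r h₁ T δ : ℝ} (hr : 0 < r) (hh : 0 < h₁) (hn : meshPoint r h₁ n ≤ T) {L : ℝ≥0} {f : V → V}
    {y₀ : V} {y : ℝ → V} {γ : ℕ → ℕ → V} (hδ0 : 0 < δ) (hyc : ContinuousOn y (Icc 0 T))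
    (hf : LipschitzOnWith L f (Metric.thickening δ (y '' Icc 0 T)))
    (hvolt : ∀ t ∈ Icc 0 T,
      y t = y₀ + (1 / Real.Gamma α) • ∫ x in (0 : ℝ)..t, kern (α - 1) (t - x) • f (y x))
    {D : ℕ → ℝ}
    (hD : ∀ ν ∈ Finset.Icc 1 n, ∀ τ ∈ Icc (0 : ℝ) 1, ‖f (quasiPoly α s r h₁ y₀ γ ν τ) -
      ∑ j ∈ Finset.range s, (P α j).eval τ • γ ν j‖ ≤ D ν)
    (hδ : (∑ ν ∈ Finset.Icc 1 n, D ν * step r h₁ ν ^ α) / Real.Gamma (α + 1) * growth α L T < δ) :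
    ∀ ν ∈ Finset.Icc 1 n, ∀ c ∈ Icc (0 : ℝ) 1,
      ‖y (meshPoint r h₁ (ν - 1) + c * step r h₁ ν) - quasiPoly α s r h₁ y₀ γ ν c‖ ≤
        (∑ ν ∈ Finset.Icc 1 n, D ν * step r h₁ ν ^ α) / Real.Gamma (α + 1) * growth α L T := by
  have hΓ := Real.Gamma_pos_of_pos hα
  have hΓ1 := Real.Gamma_pos_of_pos (show 0 < α + 1 by linarith)
  have hβ : -1 < α - 1 := by linarith
  set tn := meshPoint r h₁ n with htn
  have htn0 : 0 ≤ tn := meshPoint_nonneg hr hh n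
  have hsub : Icc 0 tn ⊆ Icc 0 T := Icc_subset_Icc_right hn
  set σ := approx α s r h₁ y₀ γ n with hσ
  have hσc : Continuous σ := continuous_approx hα s r h₁ y₀ γ n
  set u : ℝ → ℝ := fun t => ‖y t - σ t‖ with hu
  have huc : ContinuousOn u (Icc 0 tn) := ((hyc.mono hsub).sub hσc.continuousOn).norm
  have hD0 : ∀ ν ∈ Finset.Icc 1 n, 0 ≤ D ν := fun ν hν =>
    (norm_nonneg _).trans (hD ν hν 0 ⟨le_rfl, zero_le_one⟩)
  set A := (∑ ν ∈ Finset.Icc 1 n, D ν * step r h₁ ν ^ α) / Real.Gamma (α + 1) with hA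
  have hA0 : 0 ≤ A := div_nonneg (Finset.sum_nonneg fun ν hν =>
    mul_nonneg (hD0 ν hν) (Real.rpow_nonneg (step_pos hr hh ν).le _)) hΓ1.le
  have hfy : ContinuousOn (fun x => f (y x)) (Icc 0 T) :=
    hf.continuousOn.comp hyc fun x hx => Metric.self_subset_thickening hδ0 _ ⟨x, hx, rfl⟩
  have hmesh : ∀ k < n, Icc (meshPoint r h₁ k) (meshPoint r h₁ (k + 1)) ⊆ Icc 0 tn :=
    fun k hk => Icc_subset_Icc (meshPoint_nonneg hr hh k) (meshPoint_mono hr hh hk)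
  have hmle : ∀ k, meshPoint r h₁ k ≤ meshPoint r h₁ (k + 1) := fun k =>
    meshPoint_mono hr hh (Nat.le_succ k)
  -- the error is the Riemann-Liouville integral of the difference of the right-hand sides
  have hrep : ∀ t ∈ Icc 0 tn, y t - σ t = (1 / Real.Gamma α) • ∑ k ∈ Finset.range n,
      ∫ x in (meshPoint r h₁ k)..(meshPoint r h₁ (k + 1)), kern (α - 1) (t - x) •
        (f (y x) - ∑ j ∈ Finset.range s,
          (P α j).eval ((x - meshPoint r h₁ k) / step r h₁ (k + 1)) • γ (k + 1) j) := by
    intro t ht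
    have h1 : ∀ k < n, IntervalIntegrable (fun x => kern (α - 1) (t - x) • f (y x)) volume
        (meshPoint r h₁ k) (meshPoint r h₁ (k + 1)) := fun k hk =>
      intervalIntegrable_kern_sub_smul hβ t (hfy.mono (by
        rw [uIcc_of_le (hmle k)]; exact (hmesh k hk).trans hsub))
    have h2 : ∫ x in (0 : ℝ)..t, kern (α - 1) (t - x) • f (y x) =
        ∑ k ∈ Finset.range n, ∫ x in (meshPoint r h₁ k)..(meshPoint r h₁ (k + 1)),
          kern (α - 1) (t - x) • f (y x) := by
      rw [intervalIntegral.sum_integral_adjacent_intervals h1, meshPoint_zero,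
        integral_kern_sub_smul_of_le hβ ht.1 le_rfl (hfy.mono
          ((Icc_subset_Icc_right ht.2).trans hsub)),
        integral_kern_sub_smul_of_le hβ ht.1 ht.2 (hfy.mono hsub)]
    rw [hvolt t (hsub ht), hσ, approx_eq_sum_integral hα s hr hh, add_sub_add_left_eq_sub,
      ← smul_sub, h2, ← Finset.sum_sub_distrib]
    congr 1
    refine Finset.sum_congr rfl fun k hk => ?_
    simp only [smul_sub]
    rw [intervalIntegral.integral_sub (h1 k (Finset.mem_range.1 hk))
      (intervalIntegrable_kern_sub_smul_sum hα s _ _ _ _ _ _)]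
  have hmain : ∀ t ∈ Icc 0 tn, (∀ x ∈ Ico 0 t, u x < δ) →
      u t ≤ A + L / Real.Gamma α * ∫ x in (0 : ℝ)..t, kern (α - 1) (t - x) * u x := by
    intro t ht hx
    have hLu : ∀ k < n, ContinuousOn (fun x => L * u x + D (k + 1))
        (uIcc (meshPoint r h₁ k) (meshPoint r h₁ (k + 1))) := fun k hk =>
      ((huc.mono (by rw [uIcc_of_le (hmle k)]; exact hmesh k hk)).const_smul (L : ℝ)).add
        continuousOn_const
    have hku : ∀ k < n, IntervalIntegrable (fun x => kern (α - 1) (t - x) * u x) volume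
        (meshPoint r h₁ k) (meshPoint r h₁ (k + 1)) := fun k hk =>
      intervalIntegrable_kern_sub_smul hβ t (huc.mono (by
        rw [uIcc_of_le (hmle k)]; exact hmesh k hk))
    have hstep : ∀ k ∈ Finset.range n,
        ‖∫ x in (meshPoint r h₁ k)..(meshPoint r h₁ (k + 1)), kern (α - 1) (t - x) •
          (f (y x) - ∑ j ∈ Finset.range s,
            (P α j).eval ((x - meshPoint r h₁ k) / step r h₁ (k + 1)) • γ (k + 1) j)‖ ≤
        L * (∫ x in (meshPoint r h₁ k)..(meshPoint r h₁ (k + 1)), kern (α - 1) (t - x) * u x) +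
          D (k + 1) * (step r h₁ (k + 1) ^ α / α) := by
      intro k hk
      have hkn := Finset.mem_range.1 hk
      have hkmem : k + 1 ∈ Finset.Icc 1 n := Finset.mem_Icc.2 ⟨by omega, hkn⟩
      have hs := step_pos (n := k + 1) hr hh
      calc _ ≤ ∫ x in (meshPoint r h₁ k)..(meshPoint r h₁ (k + 1)),
            kern (α - 1) (t - x) * (L * u x + D (k + 1)) := by
            refine intervalIntegral.norm_integral_le_of_norm_le (hmle k)
              (Filter.Eventually.of_forall fun x hxk => ?_)
              (intervalIntegrable_kern_sub_smul hβ t (hLu k hkn))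
            rw [norm_smul, Real.norm_of_nonneg (kern_nonneg _ _)]
            rcases le_or_gt t x with htx | htx
            · rw [kern_of_nonpos _ (by linarith), zero_mul, zero_mul]
            · refine mul_le_mul_of_nonneg_left ?_ (kern_nonneg _ _)
              have hxT := hsub (hmesh k hkn (Ioc_subset_Icc_self hxk))
              set τ := (x - meshPoint r h₁ k) / step r h₁ (k + 1) with hτ
              have hτ01 : τ ∈ Icc (0 : ℝ) 1 := by
                have h1 := meshPoint_succ r h₁ k
                refine ⟨div_nonneg (by linarith [hxk.1]) hs.le, (div_le_one hs).2 ?_⟩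
                linarith [hxk.2]
              have hxτ : σ x = quasiPoly α s r h₁ y₀ γ (k + 1) τ := by
                rw [← approx_eq_quasiPoly hα s hr hh y₀ γ hkmem hτ01, hσ, Nat.add_sub_cancel, hτ,
                  div_mul_cancel₀ _ hs.ne', add_sub_cancel]
              have hσmem : σ x ∈ Metric.thickening δ (y '' Icc 0 T) := by
                refine Metric.mem_thickening_iff.2 ⟨y x, ⟨x, hxT, rfl⟩, ?_⟩
                rw [dist_comm, dist_eq_norm]
                exact hx x ⟨hxT.1, htx⟩
              have hlip : ‖f (y x) - f (σ x)‖ ≤ L * u x := by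
                have := hf.dist_le_mul (y x) (Metric.self_subset_thickening hδ0 _ ⟨x, hxT, rfl⟩)
                  (σ x) hσmem
                rwa [dist_eq_norm, dist_eq_norm] at this
              have hdef := hD (k + 1) hkmem τ hτ01
              rw [← hxτ] at hdef
              refine (norm_sub_le_norm_sub_add_norm_sub _ (f (σ x)) _).trans ?_
              exact add_le_add hlip hdef
        _ = L * (∫ x in (meshPoint r h₁ k)..(meshPoint r h₁ (k + 1)),
              kern (α - 1) (t - x) * u x) + D (k + 1) *
              ∫ x in (meshPoint r h₁ k)..(meshPoint r h₁ (k + 1)), kern (α - 1) (t - x) := by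
            rw [← intervalIntegral.integral_const_mul, ← intervalIntegral.integral_const_mul,
              ← intervalIntegral.integral_add ((hku k hkn).const_mul _)
                ((intervalIntegrable_kern_sub hβ _ _ _).const_mul _)]
            refine intervalIntegral.integral_congr fun x _ => ?_
            ring
        _ ≤ _ := by
            have h1 := integral_kern_sub_le hα hα1 t (hmle k)
            have h2 : meshPoint r h₁ (k + 1) - meshPoint r h₁ k = step r h₁ (k + 1) := by
              rw [meshPoint_succ]; ring
            rw [h2] at h1
            have := mul_le_mul_of_nonneg_left h1 (hD0 _ hkmem)
            linarith
    have hsum : ∑ k ∈ Finset.range n,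
        ∫ x in (meshPoint r h₁ k)..(meshPoint r h₁ (k + 1)), kern (α - 1) (t - x) * u x =
        ∫ x in (0 : ℝ)..t, kern (α - 1) (t - x) * u x := by
      rw [intervalIntegral.sum_integral_adjacent_intervals hku, meshPoint_zero]
      have h1 := integral_kern_sub_smul_of_le hβ ht.1 ht.2 huc
      have h2 := integral_kern_sub_smul_of_le hβ ht.1 le_rfl
        (huc.mono (Icc_subset_Icc_right ht.2))
      simp only [smul_eq_mul] at h1 h2
      rw [h1, h2]
    have hAeq : A = 1 / Real.Gamma α * ∑ k ∈ Finset.range n,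
        D (k + 1) * (step r h₁ (k + 1) ^ α / α) := by
      rw [hA, sum_Icc_one_eq_sum_range, Real.Gamma_add_one hα.ne', Finset.mul_sum,
        Finset.sum_div]
      refine Finset.sum_congr rfl fun k _ => ?_
      field_simp
    calc u t = 1 / Real.Gamma α * ‖∑ k ∈ Finset.range n,
          ∫ x in (meshPoint r h₁ k)..(meshPoint r h₁ (k + 1)), kern (α - 1) (t - x) •
          (f (y x) - ∑ j ∈ Finset.range s,
            (P α j).eval ((x - meshPoint r h₁ k) / step r h₁ (k + 1)) • γ (k + 1) j)‖ := by
          rw [hu, ← Real.norm_of_nonneg (one_div_nonneg.2 hΓ.le), ← norm_smul, ← hrep t ht]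
      _ ≤ 1 / Real.Gamma α * ∑ k ∈ Finset.range n,
          (L * (∫ x in (meshPoint r h₁ k)..(meshPoint r h₁ (k + 1)), kern (α - 1) (t - x) * u x) +
          D (k + 1) * (step r h₁ (k + 1) ^ α / α)) :=
          mul_le_mul_of_nonneg_left (norm_sum_le_of_le _ hstep) (one_div_nonneg.2 hΓ.le)
      _ = _ := by
          rw [Finset.sum_add_distrib, ← Finset.mul_sum, hsum, hAeq]
          ring
  have hgrow : A * growth α L tn ≤ A * growth α L T :=
    mul_le_mul_of_nonneg_left (growth_mono L.2 hn) hA0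
  have hfinal := le_mul_growth_of_lt hα L.2 huc (fun t _ => norm_nonneg _) hA0
    (hgrow.trans_lt hδ) hmain
  intro ν hν c hc
  obtain ⟨k, rfl⟩ : ∃ k, ν = k + 1 := ⟨ν - 1, by have := (Finset.mem_Icc.1 hν).1; omega⟩
  rw [← approx_eq_quasiPoly hα s hr hh y₀ γ hν hc]
  refine (hfinal _ (hmesh k (Finset.mem_Icc.1 hν).2 ?_)).trans hgrow
  have hs := step_pos (n := k + 1) hr hh
  have h1 := meshPoint_succ r h₁ k
  have h2 : c * step r h₁ (k + 1) ≤ 1 * step r h₁ (k + 1) := by gcongr; exact hc.2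
  have h3 := mul_nonneg hc.1 hs.le
  rw [Nat.add_sub_cancel]
  constructor <;> linarith

end Global

/-! ### Error bounds from the quadrature and truncation errors -/

section Defect

variable {V : Type*} [NormedAddCommGroup V] [NormedSpace ℝ V]

theorem norm_sub_sum_quadCoeff_le (α : ℝ) (k s : ℕ) (f : V → V) (u : ℝ → V) {Q τ : ℝ}
    (hq : ∀ j < s, ‖quadError α k f u j‖ ≤ Q) (ht : ‖truncError α s f u τ‖ ≤ Q) :
    ‖f (u τ) - ∑ j ∈ Finset.range s, (P α j).eval τ • quadCoeff α k f u j‖ ≤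
      Q * (1 + ∑ j ∈ Finset.range s, |(P α j).eval τ|) := by
  have h1 : f (u τ) - ∑ j ∈ Finset.range s, (P α j).eval τ • quadCoeff α k f u j =
      truncError α s f u τ - ∑ j ∈ Finset.range s, (P α j).eval τ • quadError α k f u j := by
    simp only [truncError, quadError, smul_sub, Finset.sum_sub_distrib]
    abel
  rw [h1, mul_add, mul_one, Finset.mul_sum]
  refine (norm_sub_le _ _).trans (add_le_add ht (norm_sum_le_of_le _ fun j hj => ?_))
  rw [norm_smul, Real.norm_eq_abs, mul_comm]
  exact mul_le_mul_of_nonneg_right (hq j (Finset.mem_range.1 hj)) (abs_nonneg _)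

theorem exists_bound_sum_abs_P (α : ℝ) (s : ℕ) :
    ∃ B : ℝ, 0 < B ∧ ∀ τ ∈ Icc (0 : ℝ) 1, 1 + ∑ j ∈ Finset.range s, |(P α j).eval τ| ≤ B := by
  obtain ⟨B, hB⟩ := isCompact_Icc.exists_bound_of_continuousOn (s := Icc (0 : ℝ) 1)
    (f := fun τ => 1 + ∑ j ∈ Finset.range s, |(P α j).eval τ|)
    (continuous_const.add (continuous_finsetSum _ fun j _ =>
      (P α j).continuous.abs)).continuousOn
  have h0 : ∀ τ : ℝ, 0 ≤ ∑ j ∈ Finset.range s, |(P α j).eval τ| := fun τ =>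
    Finset.sum_nonneg fun _ _ => abs_nonneg _
  have hle : ∀ τ ∈ Icc (0 : ℝ) 1, 1 + ∑ j ∈ Finset.range s, |(P α j).eval τ| ≤ B :=
    fun τ hτ => (le_abs_self _).trans (hB τ hτ)
  exact ⟨B, by linarith [hle 0 ⟨le_rfl, zero_le_one⟩, h0 0], hle⟩

/-- The supremum defining the error of a step is attained. -/
theorem isGreatest_stepError {α : ℝ} (hα : 0 < α) (s : ℕ) {r h₁ T : ℝ} (hr : 0 < r) (hh : 0 < h₁)
    (y₀ : V) (γ : ℕ → ℕ → V) {y : ℝ → V} (hyc : ContinuousOn y (Icc 0 T)) {ν : ℕ} (hν : 1 ≤ ν)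
    (hT : meshPoint r h₁ ν ≤ T) :
    IsGreatest (errorSet α s r h₁ y₀ γ y ν) (stepError α s r h₁ y₀ γ y ν) := by
  have hcont : ContinuousOn (fun c : ℝ => ‖y (meshPoint r h₁ (ν - 1) + c * step r h₁ ν) -
      quasiPoly α s r h₁ y₀ γ ν c‖) (Icc 0 1) := by
    refine (ContinuousOn.sub ?_ ?_).norm
    · refine hyc.comp (by fun_prop) fun c hc => ?_
      obtain ⟨k, rfl⟩ : ∃ k, ν = k + 1 := ⟨ν - 1, by omega⟩
      rw [meshPoint_succ] at hT
      have hs := step_pos (n := k + 1) hr hh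
      have h2 : c * step r h₁ (k + 1) ≤ 1 * step r h₁ (k + 1) := by gcongr; exact hc.2
      have h3 := mul_nonneg hc.1 hs.le
      have h4 := meshPoint_nonneg hr hh k
      rw [Nat.add_sub_cancel]
      constructor <;> linarith
    · refine ContinuousOn.congr (f := fun c => approx α s r h₁ y₀ γ ν
        (meshPoint r h₁ (ν - 1) + c * step r h₁ ν)) ?_ fun c hc =>
          (approx_eq_quasiPoly hα s hr hh y₀ γ (Finset.mem_Icc.2 ⟨hν, le_rfl⟩) hc).symm
      exact ((continuous_approx hα s r h₁ y₀ γ ν).comp (by fun_prop)).continuousOn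
  have hcpt : IsCompact (errorSet α s r h₁ y₀ γ y ν) := isCompact_Icc.image_of_continuousOn hcont
  exact hcpt.isGreatest_sSup ((nonempty_Icc.2 zero_le_one).image _)

end Defect

/-- If the quadrature and truncation errors of step `ν` are at most `C Q_ν`, the error of step `n`
is bounded by `∑_{ν ≤ n} Q_ν h_ν^α`, as long as this quantity is small compared to the radius `δ`
of the neighbourhood on which the Lipschitz condition holds. -/
theorem exists_stepError_le {α : ℝ} (hα : 0 < α) (hα1 : α ≤ 1) (k s : ℕ) (L : ℝ≥0) {T : ℝ}
    (hT : 0 < T) (C : ℝ) : ∃ K : ℝ, 0 < K ∧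
    ∀ (m : ℕ) (f : EuclideanSpace ℝ (Fin m) → EuclideanSpace ℝ (Fin m))
      (y₀ : EuclideanSpace ℝ (Fin m)) (y : ℝ → EuclideanSpace ℝ (Fin m)) (δ : ℝ), 0 < δ →
      IsFracSolution α T f y₀ y →
      LipschitzOnWith L f (Metric.thickening δ (y '' Icc 0 T)) →
    ∀ (r h₁ : ℝ) (N : ℕ) (γ : ℕ → ℕ → EuclideanSpace ℝ (Fin m)) (Q : ℕ → ℝ),
      0 < r → IsMesh T r h₁ N → IsDiscreteSolution α k s r h₁ N f y₀ γ → (∀ ν, 0 ≤ Q ν) →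
      (∀ ν ∈ Finset.Icc 1 N,
        (∀ j < s, ‖quadError α k f (quasiPoly α s r h₁ y₀ γ ν) j‖ ≤ C * Q ν) ∧
        ∀ τ ∈ Icc (0 : ℝ) 1, ‖truncError α s f (quasiPoly α s r h₁ y₀ γ ν) τ‖ ≤ C * Q ν) →
      K * (∑ ν ∈ Finset.Icc 1 N, Q ν * step r h₁ ν ^ α) < δ →
    ∀ n ∈ Finset.Icc 1 N,
      IsGreatest (errorSet α s r h₁ y₀ γ y n) (stepError α s r h₁ y₀ γ y n) ∧
      stepError α s r h₁ y₀ γ y n ≤ K * ∑ ν ∈ Finset.Icc 1 n, Q ν * step r h₁ ν ^ α := by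
  obtain ⟨B, hB0, hB⟩ := exists_bound_sum_abs_P α s
  have hΓ1 := Real.Gamma_pos_of_pos (show 0 < α + 1 by linarith)
  have hG := growth_pos α L T
  set C' := max C 1 with hC'
  have hC'0 : 0 < C' := zero_lt_one.trans_le (le_max_right _ _)
  refine ⟨C' * B / Real.Gamma (α + 1) * growth α L T, by positivity, ?_⟩
  intro m f y₀ y δ hδ hsol hlip r h₁ N γ Q hr hmesh hdisc hQ hreg hsmall n hn
  obtain ⟨hn1, hnN⟩ := Finset.mem_Icc.1 hn
  have hh := hmesh.pos
  have hnT : meshPoint r h₁ n ≤ T := hmesh.total ▸ meshPoint_mono hr hh hnN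
  have hyc : ContinuousOn y (Icc 0 T) := by
    simpa [uIcc_of_le hT.le] using hsol.absCont.continuousOn
  have hfy : ContinuousOn (fun x => f (y x)) (Icc 0 T) :=
    hlip.continuousOn.comp hyc fun x hx => Metric.self_subset_thickening hδ _ ⟨x, hx, rfl⟩
  have hgr := isGreatest_stepError hα s hr hh y₀ γ hyc hn1 hnT
  refine ⟨hgr, ?_⟩
  have hD : ∀ ν ∈ Finset.Icc 1 n, ∀ τ ∈ Icc (0 : ℝ) 1, ‖f (quasiPoly α s r h₁ y₀ γ ν τ) -
      ∑ j ∈ Finset.range s, (P α j).eval τ • γ ν j‖ ≤ C' * B * Q ν := by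
    intro ν hν τ hτ
    have hνN := Finset.Icc_subset_Icc_right hnN hν
    have hCQ : C * Q ν ≤ C' * Q ν := mul_le_mul_of_nonneg_right (le_max_left _ _) (hQ ν)
    rw [Finset.sum_congr rfl fun j hj => by rw [hdisc ν hνN j (Finset.mem_range.1 hj)]]
    refine (norm_sub_sum_quadCoeff_le α k s f _ (fun j hj => ((hreg ν hνN).1 j hj).trans hCQ)
      (((hreg ν hνN).2 τ hτ).trans hCQ)).trans ?_
    have := mul_le_mul_of_nonneg_left (hB τ hτ) (mul_nonneg hC'0.le (hQ ν))
    linarith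
  have heq : (∑ ν ∈ Finset.Icc 1 n, C' * B * Q ν * step r h₁ ν ^ α) / Real.Gamma (α + 1) *
      growth α L T = C' * B / Real.Gamma (α + 1) * growth α L T *
        ∑ ν ∈ Finset.Icc 1 n, Q ν * step r h₁ ν ^ α := by
    simp only [mul_assoc (C' * B), ← Finset.mul_sum]
    ring
  have hle : ∑ ν ∈ Finset.Icc 1 n, Q ν * step r h₁ ν ^ α ≤
      ∑ ν ∈ Finset.Icc 1 N, Q ν * step r h₁ ν ^ α :=
    Finset.sum_le_sum_of_subset_of_nonneg (Finset.Icc_subset_Icc_right hnN) fun ν _ _ =>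
      mul_nonneg (hQ ν) (Real.rpow_nonneg (step_pos hr hh ν).le _)
  have hmain := norm_sub_quasiPoly_le hα hα1 hr hh hnT hδ hyc hlip
    (fun t ht => hsol.eq_add_integral hα hα1 hT hfy ht) hD (by
      rw [heq]
      exact (mul_le_mul_of_nonneg_left hle (by positivity)).trans_lt hsmall)
  obtain ⟨c, hc, hceq⟩ := hgr.1
  rw [← hceq, ← heq]
  exact hmain n (Finset.mem_Icc.2 ⟨hn1, le_rfl⟩) c hc

/-! ### Sums of powers of the steps -/

theorem pow_mul_rpow_eq {x : ℝ} (hx : 0 < x) (s : ℕ) (α : ℝ) : x ^ s * x ^ α = x ^ (s + α) := by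
  rw [Real.rpow_add hx, Real.rpow_natCast]

/-- In contrast to the geometric sum, this bound is uniform in `r` as `r → 1`; it keeps the error
below `δ` for small steps. -/
theorem sum_step_rpow_le {r h₁ : ℝ} (hr : 1 ≤ r) (hh : 0 < h₁) {p : ℝ} (hp : 1 ≤ p) (n : ℕ) :
    ∑ ν ∈ Finset.Icc 1 n, step r h₁ ν ^ p ≤ meshPoint r h₁ n * step r h₁ n ^ (p - 1) := by
  rw [meshPoint, Finset.sum_mul]
  refine Finset.sum_le_sum fun ν hν => ?_
  have hs := step_pos (zero_lt_one.trans_le hr) hh ν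
  calc step r h₁ ν ^ p = step r h₁ ν * step r h₁ ν ^ (p - 1) := by
        rw [Real.rpow_sub_one hs.ne']; field_simp
    _ ≤ _ := mul_le_mul_of_nonneg_left (Real.rpow_le_rpow hs.le
        (step_mono hr hh (Finset.mem_Icc.1 hν).2) (by linarith)) hs.le

theorem one_sub_rpow_neg_pos {r p : ℝ} (hr : 1 < r) (hp : 0 < p) : 0 < 1 - r ^ (-p) :=
  sub_pos.2 (Real.rpow_lt_one_of_one_lt_of_neg hr (by linarith))

/-- The geometric sum behind the second summand of the error bound. -/
theorem sum_step_rpow_le_div {r h₁ : ℝ} (hr : 1 < r) (hh : 0 < h₁) {p : ℝ} (hp : 0 < p) (n : ℕ) :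
    ∑ ν ∈ Finset.Icc 1 (n + 1), step r h₁ ν ^ p ≤
      step r h₁ (n + 1) ^ p / (1 - r ^ (-p)) := by
  have hr0 : 0 < r := zero_lt_one.trans hr
  have hq := one_sub_rpow_neg_pos hr hp
  have hq' : 0 < r ^ (-p) := Real.rpow_pos_of_pos hr0 _
  induction n with
  | zero =>
    have := Real.rpow_nonneg (step_pos hr0 hh 1).le p
    rw [zero_add, Finset.Icc_self, Finset.sum_singleton, le_div_iff₀ hq]
    nlinarith
  | succ n ih =>
    rw [Finset.sum_Icc_succ_top (by omega)]
    refine (add_le_add_left ih _).trans (le_of_eq ?_)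
    have h1 : step r h₁ (n + 1) ^ p = r ^ (-p) * step r h₁ (n + 1 + 1) ^ p := by
      have h2 : step r h₁ (n + 1 + 1) = r * step r h₁ (n + 1) := by
        rw [step_succ, step_succ, pow_succ]; ring
      rw [h2, Real.mul_rpow hr0.le (step_pos hr0 hh _).le, ← mul_assoc, ← Real.rpow_add hr0]
      simp
    rw [h1]
    field_simp
    ring

theorem boundTerm_mono {α : ℝ} (hα : 0 < α) (s : ℕ) {r h₁ : ℝ} (hr : 1 < r) (hh : 0 < h₁)
    {n N : ℕ} (hnN : n ≤ N) : boundTerm α s r h₁ n ≤ boundTerm α s r h₁ N := by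
  have hp : 0 < s + α := by positivity
  have hq := one_sub_rpow_neg_pos hr hp
  have hs := (step_pos (zero_lt_one.trans hr) hh n).le
  have hst := step_mono hr.le hh hnN
  unfold boundTerm
  gcongr

/-! ### Graded meshes and constant steps -/

theorem graded_error_bound {α : ℝ} (hα : 0 < α) (hα1 : α ≤ 1) {k s : ℕ} (hs : 1 ≤ s)
    (hsk : s ≤ k) (L : ℝ≥0) {T : ℝ} (hT : 0 < T) (C : ℝ) : ∃ K : ℝ, 0 < K ∧
      ∀ δ : ℝ, 0 < δ → ∃ h₀ : ℝ, 0 < h₀ ∧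
      ∀ (m : ℕ) (f : EuclideanSpace ℝ (Fin m) → EuclideanSpace ℝ (Fin m))
        (y₀ : EuclideanSpace ℝ (Fin m)) (y : ℝ → EuclideanSpace ℝ (Fin m)),
        IsFracSolution α T f y₀ y →
        LipschitzOnWith L f (Metric.thickening δ (y '' Icc 0 T)) →
      ∀ (r h₁ : ℝ) (N : ℕ) (γ : ℕ → ℕ → EuclideanSpace ℝ (Fin m)),
        1 < r → IsMesh T r h₁ N → step r h₁ N ≤ h₀ →
        IsDiscreteSolution α k s r h₁ N f y₀ γ →
        SingularFirstStepBounds C α k s r h₁ f y₀ γ →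
        (∀ ν ∈ Finset.Icc 2 N, RegularStepBounds C α k s r h₁ f y₀ γ ν) →
      ∀ n < N,
        IsGreatest (errorSet α s r h₁ y₀ γ y (n + 1)) (stepError α s r h₁ y₀ γ y (n + 1)) ∧
        stepError α s r h₁ y₀ γ y (n + 1) ≤ K * boundTerm α s r h₁ (n + 1) := by
  have hCC : C ≤ max C 0 := le_max_left _ _
  have hC0 : 0 ≤ max C 0 := le_max_right _ _
  obtain ⟨K, hK, hmain⟩ := exists_stepError_le hα hα1 k s L hT (max C 0)
  refine ⟨K, hK, fun δ hδ => ?_⟩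
  have hs1 : (1 : ℝ) ≤ s := by exact_mod_cast hs
  have hp : 1 ≤ (s : ℝ) + α := by linarith
  have hlim : Filter.Tendsto (fun h : ℝ => K * (h ^ (2 * α) + T * h ^ ((s : ℝ) + α - 1)))
      (nhdsWithin 0 (Ioi 0)) (nhds 0) := by
    have h1 : ContinuousAt (fun h : ℝ => K * (h ^ (2 * α) + T * h ^ ((s : ℝ) + α - 1))) 0 :=
      continuousAt_const.mul ((Real.continuousAt_rpow_const _ _ (Or.inr (by linarith))).add
        (continuousAt_const.mul (Real.continuousAt_rpow_const _ _ (Or.inr (by linarith)))))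
    have h2 := h1.tendsto
    rw [Real.zero_rpow (by linarith), Real.zero_rpow (by linarith)] at h2
    simpa using h2.mono_left nhdsWithin_le_nhds
  obtain ⟨h₀, hh₀δ, hh₀⟩ := ((hlim.eventually (gt_mem_nhds hδ)).and
    (Ioo_mem_nhdsGT (zero_lt_one' ℝ))).exists
  refine ⟨h₀, hh₀.1, ?_⟩
  intro m f y₀ y hsol hlip r h₁ N γ hr hmesh hstep hdisc hfirst hreg n hn
  have hh := hmesh.pos
  have hr0 : 0 < r := zero_lt_one.trans hr
  have hstep1 : step r h₁ 1 = h₁ := by simp [step]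
  -- `2k - j ≥ s`, so for steps below `1` both errors of a regular step are at most `C h_ν^s`
  set Q : ℕ → ℝ := fun ν => if ν = 1 then h₁ ^ α else step r h₁ ν ^ s with hQ
  have hQ0 : ∀ ν, 0 ≤ Q ν := by
    intro ν
    simp only [hQ]
    split_ifs
    · exact Real.rpow_nonneg hh.le _
    · exact pow_nonneg (step_pos hr0 hh ν).le _
  have hbounds : ∀ ν ∈ Finset.Icc 1 N,
      (∀ j < s, ‖quadError α k f (quasiPoly α s r h₁ y₀ γ ν) j‖ ≤ max C 0 * Q ν) ∧
      ∀ τ ∈ Icc (0 : ℝ) 1, ‖truncError α s f (quasiPoly α s r h₁ y₀ γ ν) τ‖ ≤ max C 0 * Q ν := by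
    intro ν hν
    obtain ⟨hν1, hνN⟩ := Finset.mem_Icc.1 hν
    rcases eq_or_ne ν 1 with rfl | hne
    · have hQ1 : C * h₁ ^ α ≤ max C 0 * Q 1 := by
        simp only [hQ, if_true]
        exact mul_le_mul_of_nonneg_right hCC (Real.rpow_nonneg hh.le _)
      exact ⟨fun j hj => (hfirst.1 j hj).trans hQ1, fun τ hτ => (hfirst.2 τ hτ).trans hQ1⟩
    · have hst := step_pos hr0 hh ν
      have hst1 : step r h₁ ν ≤ 1 := (step_mono hr.le hh hνN).trans (hstep.trans hh₀.2.le)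
      have hQν : Q ν = step r h₁ ν ^ s := by simp only [hQ, if_neg hne]
      obtain ⟨h1, h2⟩ := hreg ν (Finset.mem_Icc.2 ⟨by omega, hνN⟩)
      rw [hQν]
      refine ⟨fun j hj => (h1 j hj).trans ?_, fun τ hτ => (h2 τ hτ).trans ?_⟩
      · exact mul_le_mul hCC (pow_le_pow_of_le_one hst.le hst1 (by omega)) (pow_pos hst _).le hC0
      · exact mul_le_mul_of_nonneg_right hCC (pow_pos hst _).le
  have hsum : ∀ n, 1 ≤ n → ∑ ν ∈ Finset.Icc 1 n, Q ν * step r h₁ ν ^ α ≤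
      h₁ ^ (2 * α) + ∑ ν ∈ Finset.Icc 1 n, step r h₁ ν ^ ((s : ℝ) + α) := by
    intro n hn
    have h1 : ∀ ν ∈ Finset.Icc 1 n, Q ν * step r h₁ ν ^ α ≤
        (if ν = 1 then h₁ ^ (2 * α) else 0) + step r h₁ ν ^ ((s : ℝ) + α) := by
      intro ν _
      have hst := step_pos hr0 hh ν
      rcases eq_or_ne ν 1 with rfl | hne
      · simp only [hQ, if_true, hstep1]
        rw [← Real.rpow_add hh, two_mul]
        linarith [Real.rpow_nonneg hh.le ((s : ℝ) + α)]
      · simp only [hQ, if_neg hne]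
        rw [pow_mul_rpow_eq hst, zero_add]
    refine (Finset.sum_le_sum h1).trans (le_of_eq ?_)
    rw [Finset.sum_add_distrib, Finset.sum_ite_eq', if_pos (Finset.mem_Icc.2 ⟨le_rfl, hn⟩)]
  have hsmall : K * (∑ ν ∈ Finset.Icc 1 N, Q ν * step r h₁ ν ^ α) < δ := by
    refine lt_of_le_of_lt (mul_le_mul_of_nonneg_left ((hsum N hmesh.one_le).trans ?_) hK.le) hh₀δ
    have h1 := sum_step_rpow_le hr.le hh hp N
    rw [hmesh.total] at h1
    have h2 : h₁ ≤ h₀ := by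
      rw [← hstep1]; exact (step_mono hr.le hh hmesh.one_le).trans hstep
    have h3 : h₁ ^ (2 * α) ≤ h₀ ^ (2 * α) := Real.rpow_le_rpow hh.le h2 (by linarith)
    have h4 : step r h₁ N ^ ((s : ℝ) + α - 1) ≤ h₀ ^ ((s : ℝ) + α - 1) :=
      Real.rpow_le_rpow (step_pos hr0 hh N).le hstep (by linarith)
    exact add_le_add h3 (h1.trans (mul_le_mul_of_nonneg_left h4 hT.le))
  obtain ⟨hgr, hle⟩ := hmain m f y₀ y δ hδ hsol hlip r h₁ N γ Q hr0 hmesh hdisc hQ0 hbounds hsmall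
    (n + 1) (Finset.mem_Icc.2 ⟨by omega, hn⟩)
  refine ⟨hgr, hle.trans (mul_le_mul_of_nonneg_left ((hsum (n + 1) (by omega)).trans ?_) hK.le)⟩
  refine add_le_add ?_ (sum_step_rpow_le_div hr hh (by linarith) n)
  have h1 : (1 : ℝ) ≤ ((n + 1 : ℕ) : ℝ) := by exact_mod_cast Nat.le_add_left 1 n
  exact le_mul_of_one_le_left (Real.rpow_nonneg hh.le _) h1

theorem constant_step_error_bound {α : ℝ} (hα : 0 < α) (hα1 : α ≤ 1) {k s : ℕ} (hs : 1 ≤ s)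
    (hsk : s ≤ k) (L : ℝ≥0) {T : ℝ} (hT : 0 < T) (C : ℝ) : ∃ K : ℝ, 0 < K ∧
      ∀ δ : ℝ, 0 < δ → ∃ h₀ : ℝ, 0 < h₀ ∧
      ∀ (m : ℕ) (f : EuclideanSpace ℝ (Fin m) → EuclideanSpace ℝ (Fin m))
        (y₀ : EuclideanSpace ℝ (Fin m)) (y : ℝ → EuclideanSpace ℝ (Fin m)),
        IsFracSolution α T f y₀ y →
        LipschitzOnWith L f (Metric.thickening δ (y '' Icc 0 T)) →
      ∀ (h : ℝ) (N : ℕ) (γ : ℕ → ℕ → EuclideanSpace ℝ (Fin m)),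
        IsMesh T 1 h N → h ≤ h₀ →
        IsDiscreteSolution α k s 1 h N f y₀ γ →
        (∀ ν ∈ Finset.Icc 1 N, RegularStepBounds C α k s 1 h f y₀ γ ν) →
      ∀ n ∈ Finset.Icc 1 N,
        IsGreatest (errorSet α s 1 h y₀ γ y n) (stepError α s 1 h y₀ γ y n) ∧
        stepError α s 1 h y₀ γ y n ≤ K * (n * h ^ (s + α)) := by
  have hCC : C ≤ max C 0 := le_max_left _ _
  have hC0 : 0 ≤ max C 0 := le_max_right _ _
  obtain ⟨K, hK, hmain⟩ := exists_stepError_le hα hα1 k s L hT (max C 0)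
  refine ⟨K, hK, fun δ hδ => ?_⟩
  have hs1 : (1 : ℝ) ≤ s := by exact_mod_cast hs
  have hlim : Filter.Tendsto (fun h : ℝ => K * (T * h ^ ((s : ℝ) + α - 1)))
      (nhdsWithin 0 (Ioi 0)) (nhds 0) := by
    have h1 : ContinuousAt (fun h : ℝ => K * (T * h ^ ((s : ℝ) + α - 1))) 0 :=
      continuousAt_const.mul (continuousAt_const.mul
        (Real.continuousAt_rpow_const _ _ (Or.inr (by linarith))))
    have h2 := h1.tendsto
    rw [Real.zero_rpow (by linarith)] at h2
    simpa using h2.mono_left nhdsWithin_le_nhds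
  obtain ⟨h₀, hh₀δ, hh₀⟩ := ((hlim.eventually (gt_mem_nhds hδ)).and
    (Ioo_mem_nhdsGT (zero_lt_one' ℝ))).exists
  refine ⟨h₀, hh₀.1, ?_⟩
  intro m f y₀ y hsol hlip h N γ hmesh hstep hdisc hreg n hn
  have hh := hmesh.pos
  have hst : ∀ ν, step 1 h ν = h := fun ν => by simp [step]
  have hsum : ∀ n : ℕ, ∑ ν ∈ Finset.Icc 1 n, h ^ s * step 1 h ν ^ α = n * h ^ ((s : ℝ) + α) := by
    intro n
    simp only [hst, pow_mul_rpow_eq hh, Finset.sum_const, Nat.card_Icc, Nat.add_sub_cancel,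
      nsmul_eq_mul]
  have hbounds : ∀ ν ∈ Finset.Icc 1 N,
      (∀ j < s, ‖quadError α k f (quasiPoly α s 1 h y₀ γ ν) j‖ ≤ max C 0 * h ^ s) ∧
      ∀ τ ∈ Icc (0 : ℝ) 1, ‖truncError α s f (quasiPoly α s 1 h y₀ γ ν) τ‖ ≤ max C 0 * h ^ s := by
    intro ν hν
    obtain ⟨h1, h2⟩ := hreg ν hν
    rw [hst] at h1 h2
    refine ⟨fun j hj => (h1 j hj).trans ?_, fun τ hτ => (h2 τ hτ).trans ?_⟩
    · exact mul_le_mul hCC (pow_le_pow_of_le_one hh.le (hstep.trans hh₀.2.le) (by omega))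
        (pow_pos hh _).le hC0
    · exact mul_le_mul_of_nonneg_right hCC (pow_pos hh _).le
  have hsmall : K * (∑ ν ∈ Finset.Icc 1 N, h ^ s * step 1 h ν ^ α) < δ := by
    refine lt_of_le_of_lt (mul_le_mul_of_nonneg_left ?_ hK.le) hh₀δ
    have h1 : (N : ℝ) * h = T := by
      have := hmesh.total
      simpa [meshPoint, hst] using this
    have h2 : h ^ ((s : ℝ) + α) = h * h ^ ((s : ℝ) + α - 1) := by
      rw [Real.rpow_sub_one hh.ne']; field_simp
    rw [hsum, h2, ← mul_assoc, h1]
    exact mul_le_mul_of_nonneg_left (Real.rpow_le_rpow hh.le hstep (by linarith)) hT.le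
  have := hmain m f y₀ y δ hδ hsol hlip 1 h N γ (fun _ => h ^ s) one_pos hmesh hdisc
    (fun _ => pow_nonneg hh.le _) hbounds hsmall n hn
  rwa [hsum] at this

/-! ### The number of steps and the balanced mesh -/

theorem meshPoint_eq_mul_sum (r h₁ : ℝ) (N : ℕ) :
    meshPoint r h₁ N = h₁ * ∑ i ∈ Finset.range N, r ^ i := by
  have := meshPoint_add r h₁ 0 N
  rwa [zero_add, meshPoint_zero, zero_add, step_succ, pow_zero, one_mul] at this

theorem IsMesh.natCast_eq_logb {T r h₁ : ℝ} {N : ℕ} (hr : 1 < r) (h : IsMesh T r h₁ N) :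
    (N : ℝ) = Real.logb r (1 + T * (r - 1) / h₁) := by
  have hh := h.pos
  have h1 : 1 + T * (r - 1) / h₁ = r ^ N := by
    rw [← h.total, meshPoint_eq_mul_sum, mul_assoc, geom_sum_mul]
    field_simp
    ring
  rw [h1, Real.logb_pow, Real.logb_self_eq_one hr, mul_one]

/-- A balanced mesh exists by the intermediate value theorem: with `N` steps on `[0,T]`, the first
step is the larger term at `r = 1`, and the last step is for large `r`. -/
theorem exists_balanced_mesh {p q T : ℝ} (hq : 0 < q) (hqp : q < p) (hT : 0 < T) {N : ℕ}
    (hN : 2 ≤ N) (hNT : T < N) :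
    ∃ r h₁ : ℝ, 1 < r ∧ IsMesh T r h₁ N ∧ h₁ ^ q = step r h₁ N ^ p := by
  have hp : 0 < p := hq.trans hqp
  have hN0 : (0 : ℝ) < N := hT.trans hNT
  set S : ℝ → ℝ := fun r => ∑ i ∈ Finset.range N, r ^ i with hS
  have hS1 : ∀ r : ℝ, 1 ≤ r → r ^ (N - 1) ≤ S r := fun r hr =>
    Finset.single_le_sum (f := fun i => r ^ i) (fun i _ => by positivity)
      (Finset.mem_range.2 (by omega))
  have hSpos : ∀ r : ℝ, 1 ≤ r → 0 < S r := fun r hr =>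
    (pow_pos (zero_lt_one.trans_le hr) _).trans_le (hS1 r hr)
  have hS2 : ∀ r : ℝ, 1 ≤ r → S r ≤ N * r ^ (N - 1) := by
    intro r hr
    refine (Finset.sum_le_card_nsmul _ _ (r ^ (N - 1)) fun i hi => ?_).trans (le_of_eq ?_)
    · exact pow_le_pow_right₀ hr (by have := Finset.mem_range.1 hi; omega)
    · simp
  set g : ℝ → ℝ := fun r => (T / S r) ^ q - (r ^ (N - 1) * (T / S r)) ^ p with hg
  have hScont : Continuous S := continuous_finsetSum _ fun i _ => continuous_pow i
  have hgcont : ContinuousOn g (Ici 1) := by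
    have h1 : ContinuousOn (fun r => T / S r) (Ici 1) :=
      continuousOn_const.div hScont.continuousOn fun r hr => (hSpos r hr).ne'
    exact (h1.rpow_const fun r _ => Or.inr hq.le).sub
      (((continuous_pow (N - 1)).continuousOn.mul h1).rpow_const fun r _ => Or.inr hp.le)
  have hg1 : 0 < g 1 := by
    have h1 : S 1 = N := by simp [hS]
    simp only [hg, h1, one_pow, one_mul, sub_pos]
    exact Real.rpow_lt_rpow_of_exponent_gt (by positivity) ((div_lt_one hN0).2 hNT) hqp
  set ε := ((T / N) ^ p) ^ (1 / q) with hε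
  have hε0 : 0 < ε := by positivity
  have hεq : ε ^ q = (T / N) ^ p := by
    rw [hε, ← Real.rpow_mul (by positivity), one_div_mul_cancel hq.ne', Real.rpow_one]
  obtain ⟨R, hR1, hRε⟩ : ∃ R : ℝ, 1 < R ∧ T / R < ε := by
    refine ⟨T / ε + 1, by linarith [div_pos hT hε0], ?_⟩
    rw [div_lt_iff₀ (by positivity), mul_add, mul_div_cancel₀ _ hε0.ne']
    linarith
  have hgR : g R < 0 := by
    have hR0 : 0 < R := zero_lt_one.trans hR1
    have h1 : T / S R ≤ T / R := by
      refine div_le_div_of_nonneg_left hT.le hR0 (le_trans ?_ (hS1 R hR1.le))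
      exact le_self_pow₀ hR1.le (by omega)
    have h2 : T / N ≤ R ^ (N - 1) * (T / S R) := by
      rw [div_le_iff₀ hN0, mul_div_assoc', div_mul_eq_mul_div, le_div_iff₀ (hSpos R hR1.le)]
      have := mul_le_mul_of_nonneg_left (hS2 R hR1.le) hT.le
      linarith
    have h3 : (T / S R) ^ q < ε ^ q :=
      Real.rpow_lt_rpow (div_pos hT (hSpos R hR1.le)).le (h1.trans_lt hRε) hq
    have h4 : (T / N) ^ p ≤ (R ^ (N - 1) * (T / S R)) ^ p :=
      Real.rpow_le_rpow (by positivity) h2 hp.le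
    simp only [hg]
    linarith
  obtain ⟨r, hr, hgr⟩ := intermediate_value_Icc' hR1.le (hgcont.mono Icc_subset_Ici_self)
    ⟨hgR.le, hg1.le⟩
  have hr1 : 1 < r := by
    refine lt_of_le_of_ne hr.1 ?_
    rintro rfl
    exact hg1.ne' hgr
  have hSr := hSpos r hr.1
  refine ⟨r, T / S r, hr1, ⟨by omega, div_pos hT hSr, ?_⟩, ?_⟩
  · rw [meshPoint_eq_mul_sum]
    exact div_mul_cancel₀ _ hSr.ne'
  · exact sub_eq_zero.1 hgr

/-! ### Optimality of the balance up to a logarithm -/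

section Mesh

variable {T r h₁ : ℝ} {N : ℕ}

theorem IsMesh.mul_sub_one_eq (h : IsMesh T r h₁ N) : T * (r - 1) = r * step r h₁ N - h₁ := by
  have h1 : r ^ N = r * r ^ (N - 1) := by
    rw [← pow_succ', Nat.sub_add_cancel h.one_le]
  rw [← h.total, meshPoint_eq_mul_sum, mul_assoc, geom_sum_mul, h1, step]
  ring

theorem IsMesh.le_mul_step (hr : 1 ≤ r) (h : IsMesh T r h₁ N) : T ≤ N * step r h₁ N := by
  rw [← h.total, meshPoint]
  refine (Finset.sum_le_card_nsmul _ _ (step r h₁ N) fun i hi => ?_).trans (le_of_eq (by simp))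
  exact step_mono hr h.pos (Finset.mem_Icc.1 hi).2

theorem IsMesh.mul_first_step_le (hr : 1 ≤ r) (h : IsMesh T r h₁ N) : N * h₁ ≤ T := by
  rw [← h.total, meshPoint]
  refine le_trans (le_of_eq (by simp)) (Finset.card_nsmul_le_sum _ _ h₁ fun i hi => ?_)
  have := step_mono hr h.pos (Finset.mem_Icc.1 hi).1
  simpa [step] using this

theorem IsMesh.log_step (hr : 1 ≤ r) (h : IsMesh T r h₁ N) :
    Real.log (step r h₁ N) = ((N : ℝ) - 1) * Real.log r + Real.log h₁ := by
  have hr0 : 0 < r := zero_lt_one.trans_le hr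
  rw [step, Real.log_mul (pow_pos hr0 _).ne' h.pos.ne', Real.log_pow, Nat.cast_sub h.one_le,
    Nat.cast_one]

theorem IsMesh.mul_one_sub_inv_le (hr : 1 ≤ r) (h : IsMesh T r h₁ N) :
    T * (1 - r⁻¹) ≤ step r h₁ N := by
  have hr0 : 0 < r := zero_lt_one.trans_le hr
  have h1 : T * (1 - r⁻¹) = step r h₁ N - h₁ / r := by
    have := h.mul_sub_one_eq
    field_simp
    linarith
  rw [h1]
  linarith [div_pos h.pos hr0]

end Mesh

theorem tendsto_log_div_natCast : Tendsto (fun N : ℕ => Real.log N / N) atTop (nhds 0) :=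
  (Real.isLittleO_log_id_atTop.tendsto_div_nhds_zero).comp tendsto_natCast_atTop_atTop

/-- The lower estimate of the bound on all meshes. A last step of size at least `ε log N / N` makes
the second summand large; otherwise the ratio `r` is so close to `1` that the first step is not
small enough, and the first summand is large. -/
theorem exists_le_bound {p q T : ℝ} (hq : 0 < q) (hqp : q < p) (hp : 1 ≤ p) (hT : 0 < T) :
    ∃ c : ℝ, 0 < c ∧ ∀ᶠ N : ℕ in atTop, ∀ r h₁ : ℝ, 1 < r → IsMesh T r h₁ N →
      c * (Real.log N / N) ^ (p - 1) ≤
        N * h₁ ^ q + step r h₁ N ^ p / (1 - r ^ (-p)) := by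
  have hp0 : 0 < p := hq.trans hqp
  have hp1 : 0 ≤ p - 1 := by linarith
  set ε := T * (p - q) / (4 * q) with hε
  have hε0 : 0 < ε := div_pos (mul_pos hT (by linarith)) (by linarith)
  have hc0 : 0 < min (T / p * ε ^ (p - 1)) (T ^ q) := by positivity
  refine ⟨_, hc0, ?_⟩
  have hlog : Tendsto (fun N : ℕ => Real.log N) atTop atTop :=
    Real.tendsto_log_atTop.comp tendsto_natCast_atTop_atTop
  have hev1 : ∀ᶠ N : ℕ in atTop, Real.log N / N < T / (2 * ε) :=
    tendsto_log_div_natCast.eventually (gt_mem_nhds (by positivity))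
  have hev2 : ∀ᶠ N : ℕ in atTop,
      ‖Real.log N ^ (p - 1)‖ ≤ 1 * ‖Real.exp ((p - q) / 2 * Real.log N)‖ :=
    hlog.eventually ((isLittleO_rpow_exp_pos_mul_atTop (p - 1)
      (show 0 < (p - q) / 2 by linarith)).def one_pos)
  filter_upwards [hev1, hev2, eventually_ge_atTop 2] with N hN1 hN2 hN r h₁ hr hmesh
  have hh := hmesh.pos
  have hr0 : 0 < r := zero_lt_one.trans hr
  have hN0 : (0 : ℝ) < N := by exact_mod_cast (by omega : 0 < N)
  have hN1' : (1 : ℝ) ≤ N := by exact_mod_cast (by omega : 1 ≤ N)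
  have hX0 : 0 ≤ Real.log N := Real.log_nonneg hN1'
  set X := Real.log N with hX
  set H := step r h₁ N with hH
  have hHpos : 0 < H := step_pos hr0 hh N
  have hden := one_sub_rpow_neg_pos hr hp0
  have hW0 : 0 ≤ (X / N) ^ (p - 1) := by positivity
  have hz := hmesh.mul_one_sub_inv_le hr.le
  rw [← hH] at hz
  rcases le_or_gt (ε * (X / N)) H with hcase | hcase
  · -- Bernoulli's inequality bounds the denominator
    have h1 : 1 - r ^ (-p) ≤ p * (1 - r⁻¹) := by
      have h2 := one_add_mul_self_le_rpow_one_add (s := r⁻¹ - 1)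
        (by linarith [inv_pos.2 hr0]) hp
      rw [add_sub_cancel, Real.inv_rpow hr0.le, ← Real.rpow_neg hr0.le] at h2
      linarith
    have h2 : 1 - r ^ (-p) ≤ p * H / T := by
      rw [le_div_iff₀ hT]
      have := mul_le_mul_of_nonneg_left hz hp0.le
      have := mul_le_mul_of_nonneg_right h1 hT.le
      linarith
    calc min (T / p * ε ^ (p - 1)) (T ^ q) * (X / N) ^ (p - 1)
        ≤ T / p * ε ^ (p - 1) * (X / N) ^ (p - 1) := by gcongr; exact min_le_left _ _
      _ = T / p * (ε * (X / N)) ^ (p - 1) := by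
          rw [Real.mul_rpow hε0.le (by positivity), mul_assoc]
      _ ≤ T / p * H ^ (p - 1) := by gcongr
      _ = H ^ p / (p * H / T) := by rw [Real.rpow_sub_one hHpos.ne']; field_simp
      _ ≤ H ^ p / (1 - r ^ (-p)) := by gcongr
      _ ≤ N * h₁ ^ q + H ^ p / (1 - r ^ (-p)) := by
          have : 0 ≤ N * h₁ ^ q := by positivity
          linarith
  · have hzle : T * (1 - r⁻¹) ≤ ε * (X / N) := hz.trans hcase.le
    have hr2 : r ≤ 2 := by
      have h1 : ε * (X / N) ≤ T / 2 := by
        have := mul_le_mul_of_nonneg_left hN1.le hε0.le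
        refine this.trans (le_of_eq ?_)
        field_simp
      have h2 : 1 / 2 ≤ r⁻¹ := by
        have : T * (1 - r⁻¹) ≤ T * (1 / 2) := by linarith
        linarith [le_of_mul_le_mul_left this hT]
      have := inv_anti₀ (by norm_num) h2
      rw [inv_inv] at this
      linarith
    have hlogr : Real.log r ≤ 2 * (1 - r⁻¹) := by
      have h1 : r - 1 = r * (1 - r⁻¹) := by field_simp
      have h2 : 0 ≤ 1 - r⁻¹ := by linarith [inv_le_one_of_one_le₀ hr.le]
      calc Real.log r ≤ r - 1 := Real.log_le_sub_one_of_pos hr0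
        _ = r * (1 - r⁻¹) := h1
        _ ≤ 2 * (1 - r⁻¹) := by gcongr
    have hlogr0 : 0 ≤ Real.log r := Real.log_nonneg hr.le
    have h3 : q * (((N : ℝ) - 1) * Real.log r) ≤ (p - q) / 2 * X := by
      have h4 : ((N : ℝ) - 1) * Real.log r ≤ N * (2 * (1 - r⁻¹)) := by
        refine mul_le_mul (by linarith) hlogr hlogr0 hN0.le
      have h5 : T * (N * (2 * (1 - r⁻¹))) ≤ 2 * (ε * X) := by
        have := mul_le_mul_of_nonneg_left hzle (show (0 : ℝ) ≤ 2 * N by positivity)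
        have h6 : 2 * N * (ε * (X / N)) = 2 * (ε * X) := by field_simp
        linarith
      have h7 : T * (q * (((N : ℝ) - 1) * Real.log r)) ≤ T * ((p - q) / 2 * X) := by
        have h8 := mul_le_mul_of_nonneg_left h4 (mul_nonneg hT.le hq.le)
        have h9 := mul_le_mul_of_nonneg_left h5 hq.le
        have h10 : q * (2 * (ε * X)) = T * ((p - q) / 2 * X) := by rw [hε]; field_simp; ring
        linarith
      exact le_of_mul_le_mul_left h7 hT
    have hlogH : Real.log T - X ≤ Real.log H := by
      rw [hX, ← Real.log_div hT.ne' hN0.ne']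
      refine Real.log_le_log (by positivity) ?_
      rw [div_le_iff₀ hN0, mul_comm]
      exact hmesh.le_mul_step hr.le
    have hlogh := hmesh.log_step hr.le
    rw [← hH] at hlogh
    have hmain : X + q * Real.log T - q * X - (p - q) / 2 * X ≤ X + q * Real.log h₁ := by
      have h1 : Real.log h₁ = Real.log H - ((N : ℝ) - 1) * Real.log r := by linarith
      have h2 := mul_le_mul_of_nonneg_left hlogH hq.le
      rw [h1, mul_sub]
      linarith
    have hNe : Real.exp X = N := Real.exp_log hN0
    have hXp : X ^ (p - 1) ≤ Real.exp ((p - q) / 2 * X) := by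
      rwa [one_mul, Real.norm_of_nonneg (by positivity), Real.norm_of_nonneg (Real.exp_pos _).le]
        at hN2
    calc min (T / p * ε ^ (p - 1)) (T ^ q) * (X / N) ^ (p - 1)
        ≤ T ^ q * (X / N) ^ (p - 1) := by gcongr; exact min_le_right _ _
      _ = T ^ q * (X ^ (p - 1) / Real.exp (X * (p - 1))) := by
          rw [Real.div_rpow hX0 hN0.le, Real.rpow_def_of_pos hN0]
      _ ≤ T ^ q * (Real.exp ((p - q) / 2 * X) / Real.exp (X * (p - 1))) := by gcongr
      _ = Real.exp (X + q * Real.log T - q * X - (p - q) / 2 * X) := by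
          rw [Real.rpow_def_of_pos hT, ← Real.exp_sub, ← Real.exp_add]
          ring_nf
      _ ≤ Real.exp (X + q * Real.log h₁) := Real.exp_le_exp.2 hmain
      _ = N * h₁ ^ q := by
          rw [Real.exp_add, hNe, Real.rpow_def_of_pos hh, mul_comm q]
      _ ≤ N * h₁ ^ q + H ^ p / (1 - r ^ (-p)) := by
          have : 0 ≤ H ^ p / (1 - r ^ (-p)) := by positivity
          linarith

/-- The upper estimate of the bound on balanced meshes. The balance limits `h_N / h_1 = r^(N-1)` to
a power of `N`, so `log r`, and with it `h_N`, is at most of order `log N / N`. -/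
theorem exists_bound_le {p q T c₁ : ℝ} (c₂ : ℝ) (hq : 0 < q) (hqp : q < p) (hp : 1 ≤ p)
    (hT : 0 < T) (hc₁ : 0 < c₁) :
    ∃ C : ℝ, 0 < C ∧ ∀ᶠ N : ℕ in atTop, ∀ r h₁ : ℝ, 1 < r → IsMesh T r h₁ N →
      c₁ * step r h₁ N ^ p ≤ h₁ ^ q → h₁ ^ q ≤ c₂ * step r h₁ N ^ p →
      N * h₁ ^ q + step r h₁ N ^ p / (1 - r ^ (-p)) ≤
        C * Real.log N * (Real.log N / N) ^ (p - 1) := by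
  have hp0 : 0 < p := hq.trans hqp
  have hp1 : 0 ≤ p - 1 := by linarith
  have hpq : 0 < p - q := by linarith
  set a := |(p - q) * Real.log T + Real.log c₁| with ha
  have ha0 : 0 ≤ a := abs_nonneg _
  set C₂ := (p - q + a) / q with hC₂
  have hC₂0 : 0 < C₂ := by positivity
  set C₃ := 2 * T * C₂ + T with hC₃
  have hC₃0 : 0 < C₃ := by positivity
  set c := max c₂ 0 with hc
  have hc0 : 0 ≤ c := le_max_right _ _
  refine ⟨c * C₃ ^ p + 2 * T * C₃ ^ (p - 1), by positivity, ?_⟩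
  have hev : ∀ᶠ N : ℕ in atTop, c * (C₃ * (Real.log N / N)) ^ (p - q) < (1 / 2) ^ q := by
    have h1 : Tendsto (fun N : ℕ => c * (C₃ * (Real.log N / N)) ^ (p - q)) atTop
        (nhds (c * (C₃ * 0) ^ (p - q))) :=
      ((tendsto_log_div_natCast.const_mul C₃).rpow_const (Or.inr hpq.le)).const_mul c
    rw [mul_zero, Real.zero_rpow hpq.ne', mul_zero] at h1
    exact h1.eventually (gt_mem_nhds (by positivity))
  have hev2 : ∀ᶠ N : ℕ in atTop, 1 ≤ Real.log N :=
    (Real.tendsto_log_atTop.comp tendsto_natCast_atTop_atTop).eventually_ge_atTop 1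
  filter_upwards [hev, hev2, eventually_ge_atTop 2] with N hNev hX1 hN r h₁ hr hmesh hbal₁ hbal₂
  have hh := hmesh.pos
  have hr0 : 0 < r := zero_lt_one.trans hr
  have hN2 : (2 : ℝ) ≤ N := by exact_mod_cast hN
  have hN0 : (0 : ℝ) < N := by linarith
  set X := Real.log N with hX
  have hX0 : 0 < X := by linarith
  set H := step r h₁ N with hH
  have hHpos : 0 < H := step_pos hr0 hh N
  have hlogr0 : 0 ≤ Real.log r := Real.log_nonneg hr.le
  have hbal₂' : h₁ ^ q ≤ c * H ^ p := hbal₂.trans (by gcongr; exact le_max_left _ _)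
  -- the balance bounds `log r`
  have hlogr : ((N : ℝ) - 1) * Real.log r ≤ C₂ * X := by
    have h1 : Real.log c₁ + p * Real.log H ≤ q * Real.log h₁ := by
      have := Real.log_le_log (by positivity) hbal₁
      rwa [Real.log_mul hc₁.ne' (by positivity), Real.log_rpow hHpos, Real.log_rpow hh] at this
    have h2 := hmesh.log_step hr.le
    rw [← hH] at h2
    have h3 : Real.log T - X ≤ Real.log H := by
      rw [hX, ← Real.log_div hT.ne' hN0.ne']
      refine Real.log_le_log (by positivity) ?_
      rw [div_le_iff₀ hN0, mul_comm]
      exact hmesh.le_mul_step hr.le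
    have h4 := mul_le_mul_of_nonneg_left h3 hpq.le
    have h5 : -a ≤ (p - q) * Real.log T + Real.log c₁ := neg_abs_le _
    have h6 : q * (((N : ℝ) - 1) * Real.log r) ≤ (p - q) * X + a := by
      have : q * Real.log h₁ = q * Real.log H - q * (((N : ℝ) - 1) * Real.log r) := by
        rw [h2]; ring
      linarith
    have h7 : a ≤ a * X := le_mul_of_one_le_right ha0 hX1
    rw [hC₂, div_mul_eq_mul_div, le_div_iff₀ hq]
    linarith
  have hHle : H ≤ C₃ * (X / N) := by
    have h1 : Real.log r ≤ 2 * C₂ * (X / N) := by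
      have h2 : (N : ℝ) / 2 * Real.log r ≤ ((N : ℝ) - 1) * Real.log r := by
        gcongr
        linarith
      have h3 : Real.log r * N ≤ 2 * C₂ * X := by linarith
      rw [mul_div_assoc', le_div_iff₀ hN0]
      exact h3
    have h4 : 1 - r⁻¹ ≤ Real.log r := Real.one_sub_inv_le_log_of_pos hr0
    have h5 : H = T * (1 - r⁻¹) + h₁ / r := by
      have := hmesh.mul_sub_one_eq
      rw [← hH] at this
      field_simp
      linarith
    have h6 : h₁ / r ≤ T * (X / N) := by
      have h7 : h₁ / r ≤ h₁ := div_le_self hh.le hr.le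
      have h8 : h₁ ≤ T / N := by
        rw [le_div_iff₀ hN0, mul_comm]
        exact hmesh.mul_first_step_le hr.le
      have h9 : T / N ≤ T * (X / N) := by
        rw [mul_div_assoc']
        gcongr
        exact le_mul_of_one_le_right hT.le hX1
      linarith
    have h10 : T * (1 - r⁻¹) ≤ T * (2 * C₂ * (X / N)) := by gcongr; exact h4.trans h1
    rw [h5, hC₃]
    linarith
  -- the first step is at most half of the last one, so `r` is not too close to `1`
  have hhalf : h₁ ≤ H / 2 := by
    by_contra! hcon
    have h1 : (H / 2) ^ q ≤ c * H ^ p :=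
      (Real.rpow_le_rpow (by positivity) hcon.le hq.le).trans hbal₂'
    have h2 : H ^ p = H ^ (p - q) * H ^ q := by rw [← Real.rpow_add hHpos, sub_add_cancel]
    have h3 : (H / 2) ^ q = (1 / 2) ^ q * H ^ q := by
      rw [← Real.mul_rpow (by norm_num) hHpos.le]; ring_nf
    rw [h2, h3, ← mul_assoc] at h1
    have h4 := le_of_mul_le_mul_right h1 (Real.rpow_pos_of_pos hHpos q)
    have h5 : c * H ^ (p - q) ≤ c * (C₃ * (X / N)) ^ (p - q) := by gcongr
    linarith
  have hdenle : H / (2 * T) ≤ 1 - r ^ (-p) := by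
    have h1 : r ^ (-p) ≤ r⁻¹ := by
      rw [← Real.rpow_neg_one]
      exact Real.rpow_le_rpow_of_exponent_le hr.le (by linarith)
    have h2 : H / 2 ≤ T * (1 - r⁻¹) := by
      have h3 : T * (1 - r⁻¹) = H - h₁ / r := by
        have := hmesh.mul_sub_one_eq
        rw [← hH] at this
        field_simp
        linarith
      have h4 : h₁ / r ≤ h₁ := div_le_self hh.le hr.le
      linarith
    have h5 : H / (2 * T) ≤ 1 - r⁻¹ := by
      rw [div_le_iff₀ (by positivity)]
      linarith
    linarith
  have hfirst : N * h₁ ^ q ≤ c * C₃ ^ p * X * (X / N) ^ (p - 1) := by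
    calc N * h₁ ^ q ≤ N * (c * (C₃ * (X / N)) ^ p) := by
          gcongr
          exact hbal₂'.trans (by gcongr)
      _ = c * C₃ ^ p * X * (X / N) ^ (p - 1) := by
          rw [Real.mul_rpow hC₃0.le (by positivity),
            Real.rpow_sub_one (show X / N ≠ 0 by positivity)]
          field_simp
  have hsecond : H ^ p / (1 - r ^ (-p)) ≤ 2 * T * C₃ ^ (p - 1) * X * (X / N) ^ (p - 1) := by
    calc H ^ p / (1 - r ^ (-p)) ≤ H ^ p / (H / (2 * T)) := by gcongr
      _ = 2 * T * H ^ (p - 1) := by rw [Real.rpow_sub_one hHpos.ne']; field_simp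
      _ ≤ 2 * T * (C₃ * (X / N)) ^ (p - 1) := by gcongr
      _ = 2 * T * C₃ ^ (p - 1) * 1 * (X / N) ^ (p - 1) := by
          rw [Real.mul_rpow hC₃0.le (by positivity)]; ring
      _ ≤ _ := by gcongr
  linarith

theorem balanced_mesh_optimal {α : ℝ} (hα : 0 < α) {s : ℕ} (hs : 1 ≤ s) (hαs : α < s) {T : ℝ}
    (hT : 0 < T) {c₁ : ℝ} (c₂ : ℝ) (hc₁ : 0 < c₁) : ∃ (C : ℝ) (N₀ : ℕ), 0 < C ∧ ∀ N ≥ N₀,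
      (∃ r h₁ : ℝ, 1 < r ∧ IsMesh T r h₁ N ∧ h₁ ^ (2 * α) = step r h₁ N ^ (s + α)) ∧
      ∀ r h₁ r' h₁' : ℝ, 1 < r → IsMesh T r h₁ N → 1 < r' → IsMesh T r' h₁' N →
        c₁ * step r h₁ N ^ (s + α) ≤ h₁ ^ (2 * α) →
        h₁ ^ (2 * α) ≤ c₂ * step r h₁ N ^ (s + α) →
        boundTerm α s r h₁ N ≤ C * Real.log N * boundTerm α s r' h₁' N := by
  have hs1 : (1 : ℝ) ≤ s := by exact_mod_cast hs
  have hq : 0 < 2 * α := by linarith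
  have hqp : 2 * α < s + α := by linarith
  have hp : 1 ≤ (s : ℝ) + α := by linarith
  obtain ⟨c, hc, hlow⟩ := exists_le_bound hq hqp hp hT
  obtain ⟨C, hC, hup⟩ := exists_bound_le c₂ hq hqp hp hT hc₁
  obtain ⟨N₀, hN₀⟩ := eventually_atTop.1 (hlow.and (hup.and
    ((eventually_ge_atTop 2).and (tendsto_natCast_atTop_atTop.eventually_gt_atTop T))))
  refine ⟨C / c, N₀, div_pos hC hc, fun N hN => ?_⟩
  obtain ⟨hlowN, hupN, hN2, hNT⟩ := hN₀ N hN
  refine ⟨exists_balanced_mesh hq hqp hT hN2 hNT, ?_⟩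
  intro r h₁ r' h₁' hr hmesh hr' hmesh' hbal₁ hbal₂
  have h1 := hlowN r' h₁' hr' hmesh'
  have h2 := hupN r h₁ hr hmesh hbal₁ hbal₂
  have hlog : 0 ≤ Real.log N := Real.log_nonneg (by exact_mod_cast (by omega : 1 ≤ N))
  calc boundTerm α s r h₁ N ≤ C * Real.log N * (Real.log N / N) ^ ((s : ℝ) + α - 1) := h2
    _ = C / c * Real.log N * (c * (Real.log N / N) ^ ((s : ℝ) + α - 1)) := by field_simp
    _ ≤ C / c * Real.log N * boundTerm α s r' h₁' N :=
        mul_le_mul_of_nonneg_left h1 (by positivity)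

end FracStep

end

theorem mainTheorem1 (α : ℝ) (hα : 0 < α) (hα1 : α ≤ 1) (k s : ℕ) (hs : 1 ≤ s) (hsk : s ≤ k) :
    -- the error bound on graded meshes
    (∀ L : ℝ≥0, ∃ K₁ : ℝ, 0 < K₁ ∧ ∀ T : ℝ, 0 < T → ∀ C : ℝ, ∃ K : ℝ, 0 < K ∧
      ∀ δ : ℝ, 0 < δ → ∃ h₀ : ℝ, 0 < h₀ ∧
      ∀ (m : ℕ) (f : EuclideanSpace ℝ (Fin m) → EuclideanSpace ℝ (Fin m))
        (y₀ : EuclideanSpace ℝ (Fin m)) (y : ℝ → EuclideanSpace ℝ (Fin m)),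
        FracStep.IsFracSolution α T f y₀ y →
        LipschitzOnWith L f (Metric.thickening δ (y '' Set.Icc 0 T)) →
      ∀ (r h₁ : ℝ) (N : ℕ) (γ : ℕ → ℕ → EuclideanSpace ℝ (Fin m)),
        1 < r → FracStep.IsMesh T r h₁ N → FracStep.step r h₁ N ≤ h₀ →
        FracStep.IsDiscreteSolution α k s r h₁ N f y₀ γ →
        FracStep.SingularFirstStepBounds C α k s r h₁ f y₀ γ →
        (∀ ν ∈ Finset.Icc 2 N, FracStep.RegularStepBounds C α k s r h₁ f y₀ γ ν) →
      ∀ n < N,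
        IsGreatest (FracStep.errorSet α s r h₁ y₀ γ y (n + 1))
          (FracStep.stepError α s r h₁ y₀ γ y (n + 1)) ∧
        FracStep.stepError α s r h₁ y₀ γ y (n + 1) ≤
          K * Real.exp (K₁ * L * T ^ α / Real.Gamma (α + 1)) *
            FracStep.boundTerm α s r h₁ (n + 1) ∧
        FracStep.stepError α s r h₁ y₀ γ y (n + 1) ≤
          K * Real.exp (K₁ * L * T ^ α / Real.Gamma (α + 1)) *
            FracStep.boundTerm α s r h₁ N) ∧
    -- the number of steps of a graded mesh
    (∀ (T r h₁ : ℝ) (N : ℕ), 1 < r → FracStep.IsMesh T r h₁ N →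
      (N : ℝ) = Real.logb r (1 + T * (r - 1) / h₁)) ∧
    -- balanced meshes exist and are optimal for the bound, up to a factor `log N`
    (α < s → ∀ T : ℝ, 0 < T → ∀ c₁ c₂ : ℝ, 0 < c₁ → ∃ (C : ℝ) (N₀ : ℕ), 0 < C ∧ ∀ N ≥ N₀,
      (∃ r h₁ : ℝ, 1 < r ∧ FracStep.IsMesh T r h₁ N ∧
        h₁ ^ (2 * α) = FracStep.step r h₁ N ^ (s + α)) ∧
      ∀ r h₁ r' h₁' : ℝ, 1 < r → FracStep.IsMesh T r h₁ N →
        1 < r' → FracStep.IsMesh T r' h₁' N →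
        c₁ * FracStep.step r h₁ N ^ (s + α) ≤ h₁ ^ (2 * α) →
        h₁ ^ (2 * α) ≤ c₂ * FracStep.step r h₁ N ^ (s + α) →
        FracStep.boundTerm α s r h₁ N ≤
          C * Real.log N * FracStep.boundTerm α s r' h₁' N) ∧
    -- constant step, vector field regular up to `t = 0`
    (∀ (L : ℝ≥0) (T : ℝ), 0 < T → ∀ C : ℝ, ∃ K : ℝ, 0 < K ∧
      ∀ δ : ℝ, 0 < δ → ∃ h₀ : ℝ, 0 < h₀ ∧
      ∀ (m : ℕ) (f : EuclideanSpace ℝ (Fin m) → EuclideanSpace ℝ (Fin m))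
        (y₀ : EuclideanSpace ℝ (Fin m)) (y : ℝ → EuclideanSpace ℝ (Fin m)),
        FracStep.IsFracSolution α T f y₀ y →
        LipschitzOnWith L f (Metric.thickening δ (y '' Set.Icc 0 T)) →
      ∀ (h : ℝ) (N : ℕ) (γ : ℕ → ℕ → EuclideanSpace ℝ (Fin m)),
        FracStep.IsMesh T 1 h N → h ≤ h₀ →
        FracStep.IsDiscreteSolution α k s 1 h N f y₀ γ →
        (∀ ν ∈ Finset.Icc 1 N, FracStep.RegularStepBounds C α k s 1 h f y₀ γ ν) →
      ∀ n ∈ Finset.Icc 1 N,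
        IsGreatest (FracStep.errorSet α s 1 h y₀ γ y n)
          (FracStep.stepError α s 1 h y₀ γ y n) ∧
        FracStep.stepError α s 1 h y₀ γ y n ≤ K * (n * h ^ (s + α))) := by
  have hp : (0 : ℝ) < s + α := by positivity
  -- `K` may depend on `L` and `T` and already contains the Gronwall factor, so `K₁ = 1` suffices
  refine ⟨fun L => ⟨1, one_pos, fun T hT C => ?_⟩,
    fun T r h₁ N hr hmesh => hmesh.natCast_eq_logb hr,
    fun hαs T hT c₁ c₂ hc₁ => FracStep.balanced_mesh_optimal hα hs hαs hT c₂ hc₁,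
    fun L T hT C => FracStep.constant_step_error_bound hα hα1 hs hsk L hT C⟩
  obtain ⟨K, hK, hmain⟩ := FracStep.graded_error_bound hα hα1 hs hsk L hT C
  refine ⟨K, hK, fun δ hδ => ?_⟩
  obtain ⟨h₀, hh₀, hmain⟩ := hmain δ hδ
  refine ⟨h₀, hh₀, ?_⟩
  intro m f y₀ y hsol hlip r h₁ N γ hr hmesh hstep hdisc hfirst hreg n hn
  obtain ⟨hgr, hle⟩ :=
    hmain m f y₀ y hsol hlip r h₁ N γ hr hmesh hstep hdisc hfirst hreg n hn
  have hexp : 1 ≤ Real.exp (1 * L * T ^ α / Real.Gamma (α + 1)) := by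
    have := Real.Gamma_pos_of_pos (show 0 < α + 1 by linarith)
    exact Real.one_le_exp (by positivity)
  have hmono := FracStep.boundTerm_mono hα s hr hmesh.pos hn
  have hbt : 0 ≤ FracStep.boundTerm α s r h₁ (n + 1) := by
    have h1 := FracStep.one_sub_rpow_neg_pos hr hp
    have h2 := FracStep.step_pos (zero_lt_one.trans hr) hmesh.pos (n + 1)
    have h3 := hmesh.pos
    unfold FracStep.boundTerm
    positivity
  have hfin : FracStep.stepError α s r h₁ y₀ γ y (n + 1) ≤
      K * Real.exp (1 * L * T ^ α / Real.Gamma (α + 1)) * FracStep.boundTerm α s r h₁ (n + 1) :=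
    hle.trans (mul_le_mul_of_nonneg_right (le_mul_of_one_le_right hK.le hexp) hbt)
  exact ⟨hgr, hfin, hfin.trans (mul_le_mul_of_nonneg_left hmono (by positivity))⟩
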